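/- Let $(X,d)$ be a locally compact, separable, unbounded metric space, let $m$ be a positive Radon measure on $X$ with full support, and let $(\mathcal E,\mathcal F)$ be a strongly local regular Dirichlet form on the real space $L^2(X,m)$ that admits a carré du champ, i.e. a positive symmetric continuous bilinear map $\Gamma:\mathcal F\times\mathcal F\to L^1(X,m)$ such that $2\int_X h\,\Gamma(f,g)\,dm=\mathcal E(fh,g)+\mathcal E(gh,f)-\mathcal E(h,fg)$ for all $f,g,h\in\mathcal F\cap L^\infty$. Put $|\nabla u|=\Gamma(u,u)^{1/2}$ for $u\in\mathcal F$, let $\Delta\ge 0$ be the self-adjoint operator on $L^2(X,m)$ associated with $(\mathcal E,\mathcal F)$ (so $\mathcal E(u,v)=\langle\Delta u,v\rangle$ for $u$ in the domain of $\Delta$ and $v\in\mathcal F$), and let $e^{-t\Delta}$, $\Delta^{\gamma}$, $\Delta^{-\varepsilon}$ be defined by the spectral theorem. Let $\varepsilon\in(0,1)$, let $p\in(1,\infty)$, and let $p'$ be such that $\frac1p+\frac1{p'}=1$. Suppose that the quasi-Riesz transform $\nabla e^{-\Delta}\Delta^{-\varepsilon}$ is bounded on $L^{p'}$, i.e. there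 is a constant $C'>0$ such that $$\big\|\,|\nabla e^{-\Delta}\Delta^{-\varepsilon}g|\,\big\|_{p'}\le C'\,\|g\|_{p'}$$ for all $g\in L^2(X,m)\cap L^{p'}(X,m)$ in the $L^2$-domain of $\Delta^{-\varepsilon}$. Then there is a constant $C>0$ such that for every $f\in\mathcal F$ the function $e^{-\Delta}f$ belongs to the $L^2$-domain of $\Delta^{1-\varepsilon}$ and $$\big\|\Delta^{1-\varepsilon}e^{-\Delta}f\big\|_p\le C\,\big\|\,|\nabla f|\,\big\|_p$$ (where the right-hand side may be infinite). -/

import Mathlib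

open MeasureTheory Filter Topology

noncomputable section

/-- A (symmetric) Dirichlet form `(𝓔, 𝓕)` on the real Hilbert space `L²(X, m)`: a densely defined,
symmetric, nonnegative, closed bilinear form on which the unit contraction operates. -/
structure DirichletForm {X : Type*} [MeasurableSpace X] (m : Measure X) where
  /-- the domain `𝓕` -/
  domain : Submodule ℝ (Lp ℝ 2 m)
  /-- the form `𝓔` -/
  form : domain →ₗ[ℝ] domain →ₗ[ℝ] ℝ
  dense_domain : Dense (domain : Set (Lp ℝ 2 m))
  symm : ∀ u v : domain, form u v = form v u
  nonneg : ∀ u : domain, 0 ≤ form u u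
  /-- `𝓕` is complete for the norm `(𝓔(u,u) + ‖u‖₂²)^{1/2}`. -/
  closed : ∀ u : ℕ → domain,
    (∀ δ : ℝ, 0 < δ → ∃ N : ℕ, ∀ j ≥ N, ∀ k ≥ N,
      form (u j - u k) (u j - u k) + ‖((u j - u k : domain) : Lp ℝ 2 m)‖ ^ 2 < δ) →
    ∃ v : domain, Tendsto
      (fun n => form (u n - v) (u n - v) + ‖((u n - v : domain) : Lp ℝ 2 m)‖ ^ 2) atTop (𝓝 0)
  /-- the Markov property -/
  markov : ∀ u : domain, ∃ v : domain,
    ((v : Lp ℝ 2 m) : X → ℝ) =ᵐ[m] (fun x => max 0 (min ((u : Lp ℝ 2 m) x) 1)) ∧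
      form v v ≤ form u u

namespace DirichletForm

/-- Riesz representation for a positive definite symmetric bilinear form that is complete. -/
theorem riesz_aux {V : Type*} [AddCommGroup V] [Module ℝ V] (B : V →ₗ[ℝ] V →ₗ[ℝ] ℝ)
    (hsymm : ∀ u v, B u v = B v u) (hpos : ∀ u, 0 ≤ B u u) (hdef : ∀ u, B u u = 0 → u = 0)
    (hcomp : ∀ u : ℕ → V,
      (∀ δ : ℝ, 0 < δ → ∃ N : ℕ, ∀ j ≥ N, ∀ k ≥ N, B (u j - u k) (u j - u k) < δ) →
      ∃ v, Tendsto (fun n => B (u n - v) (u n - v)) atTop (𝓝 0))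
    (l : V →ₗ[ℝ] ℝ) (c : ℝ) (hl : ∀ v, |l v| ≤ c * √(B v v)) :
    ∃ u, ∀ v, B u v = l v := by
  let core : InnerProductSpace.Core ℝ V :=
    { inner := fun u v => B u v
      conj_inner_symm := fun u v => by simpa using hsymm v u
      re_inner_nonneg := fun u => by simpa using hpos u
      add_left := fun u v w => by simp
      smul_left := fun u v r => by simp
      definite := hdef }
  let _ : NormedAddCommGroup V := core.toNormedAddCommGroup
  let _ : InnerProductSpace ℝ V := InnerProductSpace.ofCore core.toCore
  have hn : ∀ v : V, ‖v‖ = √(B v v) := fun v => by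
    rw [norm_eq_sqrt_real_inner v]; rfl
  have hn2 : ∀ v : V, ‖v‖ ^ 2 = B v v := fun v => by
    rw [hn, Real.sq_sqrt (hpos v)]
  have : CompleteSpace V := by
    refine Metric.complete_of_cauchySeq_tendsto fun u hu => ?_
    obtain ⟨v, hv⟩ := hcomp u (by
      intro δ hδ
      obtain ⟨N, hN⟩ := Metric.cauchySeq_iff.1 hu (√δ) (Real.sqrt_pos.2 hδ)
      refine ⟨N, fun j hj k hk => ?_⟩
      have h := hN j hj k hk
      rw [dist_eq_norm, hn] at h
      exact (Real.sqrt_lt_sqrt_iff (hpos _)).1 h)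
    refine ⟨v, tendsto_iff_norm_sub_tendsto_zero.2 ?_⟩
    have h := (Real.continuous_sqrt.tendsto 0).comp hv
    simpa [hn, Function.comp_def] using h
  let L : V →L[ℝ] ℝ := l.mkContinuous c (fun v => by
    rw [Real.norm_eq_abs, hn]; exact hl v)
  refine ⟨(InnerProductSpace.toDual ℝ V).symm L, fun v => ?_⟩
  have h := InnerProductSpace.toDual_symm_apply (𝕜 := ℝ) (x := v) (y := L)
  exact h

variable {X : Type*} [MeasurableSpace X] {m : Measure X}

/-- `E.IsLaplacian u g` : `u` belongs to the domain of the generator `Δ` of the form and `Δ u = g`,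
i.e. `u ∈ 𝓕`, `g ∈ L²` and `𝓔(u, v) = ⟨g, v⟩` for all `v ∈ 𝓕` (so `Δ ≥ 0`). -/
def IsLaplacian (E : DirichletForm m) (u g : Lp ℝ 2 m) : Prop :=
  ∃ hu : u ∈ E.domain, ∀ v : E.domain, E.form ⟨u, hu⟩ v = inner ℝ g (v : Lp ℝ 2 m)

theorem exists_resolvent (E : DirichletForm m) (l : ℝ) (hl : 0 < l) :
    ∃ G : Lp ℝ 2 m →L[ℝ] Lp ℝ 2 m, ∀ f, E.IsLaplacian (G f) (f - l • G f) := by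
  let B : E.domain →ₗ[ℝ] E.domain →ₗ[ℝ] ℝ :=
    E.form + l • ((innerₗ (Lp ℝ 2 m)).compl₁₂ E.domain.subtype E.domain.subtype)
  have hB : ∀ u v : E.domain,
      B u v = E.form u v + l * inner ℝ (u : Lp ℝ 2 m) (v : Lp ℝ 2 m) := fun u v => by
    simp [B]
  have hB2 : ∀ u : E.domain, B u u = E.form u u + l * ‖(u : Lp ℝ 2 m)‖ ^ 2 := fun u => by
    rw [hB, real_inner_self_eq_norm_sq]
  have hpos : ∀ u, 0 ≤ B u u := fun u => by
    rw [hB2]; have := E.nonneg u; positivity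
  have hdef : ∀ u, B u u = 0 → u = 0 := fun u h => by
    rw [hB2] at h
    have h1 := E.nonneg u
    have h2 : l * ‖(u : Lp ℝ 2 m)‖ ^ 2 = 0 := by
      have : 0 ≤ l * ‖(u : Lp ℝ 2 m)‖ ^ 2 := by positivity
      linarith
    have h3 : ‖(u : Lp ℝ 2 m)‖ = 0 := by
      rcases mul_eq_zero.1 h2 with h | h
      · exact absurd h hl.ne'
      · exact pow_eq_zero_iff (two_ne_zero) |>.1 h
    exact Subtype.ext (norm_eq_zero.1 h3)
  have hcomp : ∀ u : ℕ → E.domain,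
      (∀ δ : ℝ, 0 < δ → ∃ N : ℕ, ∀ j ≥ N, ∀ k ≥ N, B (u j - u k) (u j - u k) < δ) →
      ∃ v, Tendsto (fun n => B (u n - v) (u n - v)) atTop (𝓝 0) := by
    intro u hu
    obtain ⟨v, hv⟩ := E.closed u (by
      intro δ hδ
      obtain ⟨N, hN⟩ := hu (min l 1 * δ) (by positivity)
      refine ⟨N, fun j hj k hk => ?_⟩
      have h := hN j hj k hk
      rw [hB2] at h
      have h1 := E.nonneg (u j - u k)
      have h2 : (0 : ℝ) ≤ ‖((u j - u k : E.domain) : Lp ℝ 2 m)‖ ^ 2 := by positivity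
      have h3 := mul_le_mul_of_nonneg_right (min_le_right l 1) h1
      have h4 := mul_le_mul_of_nonneg_right (min_le_left l 1) h2
      have h5 : (0 : ℝ) < min l 1 := by positivity
      refine lt_of_mul_lt_mul_left ?_ h5.le
      rw [mul_add]
      linarith)
    refine ⟨v, ?_⟩
    have hv' := hv.const_mul (max l 1)
    rw [mul_zero] at hv'
    refine squeeze_zero (fun n => hpos _) (fun n => ?_) hv'
    rw [hB2 (u n - v), mul_add]
    have h1 := E.nonneg (u n - v)
    have h2 : (0 : ℝ) ≤ ‖((u n - v : E.domain) : Lp ℝ 2 m)‖ ^ 2 := by positivity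
    have h3 := mul_le_mul_of_nonneg_right (le_max_right l 1) h1
    have h4 := mul_le_mul_of_nonneg_right (le_max_left l 1) h2
    linarith
  have hex : ∀ f : Lp ℝ 2 m, ∃ u : E.domain, ∀ v : E.domain,
      B u v = inner ℝ f (v : Lp ℝ 2 m) := by
    intro f
    refine riesz_aux B (fun u v => ?_) hpos hdef hcomp
      ((innerₗ (Lp ℝ 2 m) f).comp E.domain.subtype) (‖f‖ * (√l)⁻¹) (fun v => ?_)
    · rw [hB, hB, E.symm, real_inner_comm]
    · have h1 : |inner ℝ f (v : Lp ℝ 2 m)| ≤ ‖f‖ * ‖(v : Lp ℝ 2 m)‖ := abs_real_inner_le_norm _ _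
      have h2 : √l * ‖(v : Lp ℝ 2 m)‖ ≤ √(B v v) := by
        refine Real.le_sqrt_of_sq_le ?_
        rw [mul_pow, Real.sq_sqrt hl.le, hB2]
        have := E.nonneg v
        linarith
      have h3 : ‖(v : Lp ℝ 2 m)‖ ≤ (√l)⁻¹ * √(B v v) := by
        rw [inv_mul_eq_div, le_div_iff₀ (Real.sqrt_pos.2 hl), mul_comm]
        exact h2
      have h4 := mul_le_mul_of_nonneg_left h3 (norm_nonneg f)
      simpa [mul_assoc] using h1.trans h4
  have huniq : ∀ u u' : E.domain, (∀ v, B u v = B u' v) → u = u' := fun u u' h => by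
    have : B (u - u') (u - u') = 0 := by
      rw [LinearMap.map_sub₂, h, sub_self]
    exact sub_eq_zero.1 (hdef _ this)
  choose g hg using hex
  let G₀ : Lp ℝ 2 m →ₗ[ℝ] Lp ℝ 2 m :=
    { toFun := fun f => (g f : Lp ℝ 2 m)
      map_add' := fun f f' => by
        have : g (f + f') = g f + g f' := huniq _ _ fun v => by
          rw [hg, map_add, LinearMap.add_apply, hg, hg, inner_add_left]
        rw [this]; rfl
      map_smul' := fun r f => by
        have : g (r • f) = r • g f := huniq _ _ fun v => by
          rw [hg, map_smul, LinearMap.smul_apply, hg, real_inner_smul_left, smul_eq_mul]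
        rw [this]; rfl }
  have hbound : ∀ f, ‖G₀ f‖ ≤ l⁻¹ * ‖f‖ := fun f => by
    change ‖(g f : Lp ℝ 2 m)‖ ≤ _
    have h1 := hg f (g f)
    rw [hB2] at h1
    have h2 := E.nonneg (g f)
    have h3 := real_inner_le_norm f (g f : Lp ℝ 2 m)
    rw [inv_mul_eq_div, le_div_iff₀ hl]
    rcases (norm_nonneg (g f : Lp ℝ 2 m)).eq_or_lt with h0 | h0
    · rw [← h0, zero_mul]; exact norm_nonneg f
    · refine le_of_mul_le_mul_right ?_ h0
      nlinarith
  refine ⟨G₀.mkContinuous l⁻¹ hbound, fun f => ⟨(g f).2, fun v => ?_⟩⟩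
  have h := hg f v
  rw [hB] at h
  change E.form (g f) v = inner ℝ (f - l • (g f : Lp ℝ 2 m)) (v : Lp ℝ 2 m)
  rw [inner_sub_left, real_inner_smul_left]
  linarith

/-- The resolvent `G_l = (l + Δ)⁻¹`, `l > 0`, a bounded operator on `L²`: for every `f ∈ L²`,
`G_l f` lies in the domain of `Δ` and `Δ (G_l f) = f - l G_l f`. (Only used for `l > 0`.) -/
def resolvent (E : DirichletForm m) (l : ℝ) : Lp ℝ 2 m →L[ℝ] Lp ℝ 2 m :=
  if hl : 0 < l then (E.exists_resolvent l hl).choose else 0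

theorem isLaplacian_resolvent (E : DirichletForm m) (l : ℝ) (hl : 0 < l) (f : Lp ℝ 2 m) :
    E.IsLaplacian (E.resolvent l f) (f - l • E.resolvent l f) := by
  rw [resolvent, dif_pos hl]
  exact (E.exists_resolvent l hl).choose_spec f

/-- The heat semigroup `e^{-tΔ} f`, `t ≥ 0`, constructed from the resolvent: the limit in `L²`,
as `l → ∞`, of `exp(-t Δ_l) f`, where `Δ_l = l (1 - l (l + Δ)⁻¹)` is the (bounded) Yosida
approximation of `Δ`. -/
def heat (E : DirichletForm m) (t : ℝ) (f : Lp ℝ 2 m) : Lp ℝ 2 m :=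
  limUnder atTop (fun l : ℝ =>
    NormedSpace.exp (-(t * l) • (1 - l • E.resolvent l : Lp ℝ 2 m →L[ℝ] Lp ℝ 2 m)) f)

/-- `E.IsPow γ u w`, for `0 < γ < 1`: `u` is in the `L²`-domain of `Δ^γ` and `Δ^γ u = w`, where
`Δ^γ u = γ / Γ(1 - γ) ∫_0^∞ (u - e^{-tΔ} u) t^{-1-γ} dt`, an improper integral (at `0`)
in `L²`. By monotone convergence in the spectral representation, this is the power given by the
spectral theorem, with its exact domain. -/
def IsPow (E : DirichletForm m) (γ : ℝ) (u w : Lp ℝ 2 m) : Prop :=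
  Tendsto (fun δ : ℝ => (γ / Real.Gamma (1 - γ)) •
      ∫ t in Set.Ioi δ, (t ^ (-1 - γ) : ℝ) • (u - E.heat t u)) (𝓝[>] 0) (𝓝 w)

/-- `E.IsNegPow ε g h`, for `0 < ε < 1`: `g` is in the `L²`-domain of `Δ^{-ε}` and
`Δ^{-ε} g = h`, where `Δ^{-ε} g = 1 / Γ(ε) ∫_0^∞ e^{-tΔ} g t^{ε-1} dt`, an improper integral
(at `∞`) in `L²`. Again this is the power given by the spectral theorem, with its exact domain. -/
def IsNegPow (E : DirichletForm m) (ε : ℝ) (g h : Lp ℝ 2 m) : Prop :=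
  Tendsto (fun T : ℝ => (Real.Gamma ε)⁻¹ •
      ∫ t in (0 : ℝ)..T, (t ^ (ε - 1) : ℝ) • E.heat t g) atTop (𝓝 h)

/-- Regularity: `𝓕 ∩ C_c(X)` is dense in `𝓕` for the form norm and in `C_c(X)` for the uniform
norm. -/
def IsRegular [TopologicalSpace X] (E : DirichletForm m) : Prop :=
  (∀ u : E.domain, ∀ δ : ℝ, 0 < δ → ∃ (φ : X → ℝ) (v : E.domain),
    Continuous φ ∧ HasCompactSupport φ ∧ ((v : Lp ℝ 2 m) : X → ℝ) =ᵐ[m] φ ∧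
      E.form (u - v) (u - v) + ‖((u - v : E.domain) : Lp ℝ 2 m)‖ ^ 2 < δ) ∧
  (∀ φ : X → ℝ, Continuous φ → HasCompactSupport φ → ∀ δ : ℝ, 0 < δ →
    ∃ (ψ : X → ℝ) (v : E.domain),
      Continuous ψ ∧ HasCompactSupport ψ ∧ ((v : Lp ℝ 2 m) : X → ℝ) =ᵐ[m] ψ ∧
        ∀ x, |φ x - ψ x| < δ)

/-- The support of (the measure `|u| m` for) a class `u` of functions modulo null sets: the
complement of the largest open set on which `u = 0` almost everywhere. -/
def essSupport [TopologicalSpace X] (u : Lp ℝ 2 m) : Set X :=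
  {x | ∀ U : Set X, IsOpen U → x ∈ U → ¬ ∀ᵐ y ∂m, y ∈ U → u y = 0}

/-- Strong locality: `𝓔(u, v) = 0` whenever `u, v ∈ 𝓕` have compact support and `v` is constant in
a neighbourhood of the support of `u`. -/
def IsStronglyLocal [TopologicalSpace X] (E : DirichletForm m) : Prop :=
  ∀ u v : E.domain, IsCompact (essSupport (u : Lp ℝ 2 m)) →
    IsCompact (essSupport (v : Lp ℝ 2 m)) →
    (∃ (U : Set X) (c : ℝ), IsOpen U ∧ essSupport (u : Lp ℝ 2 m) ⊆ U ∧
      ∀ᵐ x ∂m, x ∈ U → (v : Lp ℝ 2 m) x = c) →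
    E.form u v = 0

/-- A carré du champ for the form: a positive symmetric continuous bilinear map
`Γ : 𝓕 × 𝓕 → L¹(X, m)` with
`2 ∫ h Γ(f, g) dm = 𝓔(f h, g) + 𝓔(g h, f) - 𝓔(h, f g)` for all `f, g, h ∈ 𝓕 ∩ L^∞`.
By density, `Γ` is determined by the form. -/
structure CarreDuChamp (E : DirichletForm m) where
  Γ : E.domain →ₗ[ℝ] E.domain →ₗ[ℝ] Lp ℝ 1 m
  symm : ∀ u v : E.domain, Γ u v = Γ v u
  nonneg : ∀ u : E.domain, ∀ᵐ x ∂m, 0 ≤ Γ u u x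
  continuous : ∃ C : ℝ, ∀ u : E.domain,
    ‖Γ u u‖ ≤ C * (E.form u u + ‖(u : Lp ℝ 2 m)‖ ^ 2)
  /-- `fh`, `gh`, `fg` are the products, which belong to `𝓕` again. -/
  leibniz : ∀ f g h fh gh fg : E.domain,
    MemLp (f : Lp ℝ 2 m) ⊤ m → MemLp (g : Lp ℝ 2 m) ⊤ m → MemLp (h : Lp ℝ 2 m) ⊤ m →
    ((fh : Lp ℝ 2 m) : X → ℝ) =ᵐ[m] (fun x => (f : Lp ℝ 2 m) x * (h : Lp ℝ 2 m) x) →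
    ((gh : Lp ℝ 2 m) : X → ℝ) =ᵐ[m] (fun x => (g : Lp ℝ 2 m) x * (h : Lp ℝ 2 m) x) →
    ((fg : Lp ℝ 2 m) : X → ℝ) =ᵐ[m] (fun x => (f : Lp ℝ 2 m) x * (g : Lp ℝ 2 m) x) →
    2 * ∫ x, (h : Lp ℝ 2 m) x * Γ f g x ∂m = E.form fh g + E.form gh f - E.form h fg

/-- The length of the gradient, `|∇u| = Γ(u, u)^{1/2}`, for `u ∈ 𝓕`. -/
def CarreDuChamp.gradNorm {E : DirichletForm m} (Γ : E.CarreDuChamp) (u : E.domain) : X → ℝ :=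
  fun x => √(Γ.Γ u u x)

/-- `L^q`-boundedness of the quasi-Riesz transform `∇ e^{-Δ} Δ^{-ε}`: there is `C` with
`‖ |∇ e^{-Δ} Δ^{-ε} g| ‖_q ≤ C ‖g‖_q` for all `g ∈ L² ∩ L^q` in the `L²`-domain of `Δ^{-ε}`
(the bound is void if `g ∉ L^q`). Here `h = Δ^{-ε} g` and `k = e^{-Δ} h`. -/
def CarreDuChamp.QuasiRieszBounded {E : DirichletForm m} (Γ : E.CarreDuChamp) (ε q : ℝ) : Prop :=
  ∃ C : NNReal, 0 < C ∧ ∀ g h : Lp ℝ 2 m, E.IsNegPow ε g h →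
    ∀ k : E.domain, (k : Lp ℝ 2 m) = E.heat 1 h →
      eLpNorm (Γ.gradNorm k) (ENNReal.ofReal q) m ≤ C * eLpNorm g (ENNReal.ofReal q) m

end DirichletForm

end

/-!
Put `γ = 1 - ε` and `w = Δ^γ e^{-Δ} f`. The norm `‖w‖_p` is computed by duality with bounded
functions `g` that vanish outside a set of finite measure. If `Δ^{-ε} g` is defined and
`k = e^{-Δ} Δ^{-ε} g`, then `⟨w, g⟩ = 𝓔(f, k) = ∫ Γ(f, k) dm`, so by Hölder's inequality
`|⟨w, g⟩| ≤ ‖|∇f|‖_p ‖|∇k|‖_{p'} ≤ C' ‖|∇f|‖_p ‖g‖_{p'}`.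

A general `g` need not be in the domain of `Δ^{-ε}` (for example when `Δ` has a kernel), so it is
replaced by `g_l = g - l (l + Δ)⁻¹ g = Δ (l + Δ)⁻¹ g` with `l → 0`. The operator `l (l + Δ)⁻¹` is
sub-Markovian and symmetric, hence contracts `L^{p'}`, so `‖g_l‖_{p'} ≤ 2 ‖g‖_{p'}`; and
`⟨w, g_l⟩ → ⟨w, g⟩` because `‖l (l + Δ)⁻¹ Δ^γ e^{-Δ}‖ ≤ l ^ γ`
(`DirichletForm.eLpNorm_smul_resolvent_le`, `DirichletForm.tendsto_inner_fc_sub_resolvent`).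

Two bodies of theory carry this.

* Functional calculus. Every operator involved is a continuous function of the bounded operator
  `R = (1 + Δ)⁻¹`, a symmetric operator with `0 ≤ R ≤ 1` on a real Hilbert space. The bound
  `‖p(R)‖ ≤ sup_{[0, 1]} |p|` for polynomials reduces to symmetric matrices by compression to a
  Krylov space (`IsPositiveContraction.norm_aeval_le`), and extends to `C([0, 1])` by density. With
  `r = 1 / (1 + x)`, the limits that define the heat semigroup and the fractional powers converge
  uniformly in `x`: they are limits and Bochner integrals in `C([0, 1])`, to which the calculus is
  applied (`DirichletForm.heat_eq`, `DirichletForm.isPow_heat`,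
  `DirichletForm.isNegPow_sub_resolvent`).

* The identity `𝓔(u, v) = ∫ Γ(u, v) dm` (`DirichletForm.CarreDuChamp.integral_eq_form`). For
  `u ∈ 𝓕 ∩ C_c(X)` it is the Leibniz identity with `f = g = u` and a cutoff `h`, whose term
  `𝓔(h, u ^ 2)` vanishes by strong locality. That `u ^ 2` belongs to `𝓕` is deduced from the unit
  contraction by writing `u ^ 2` as an `L²`-limit of `𝓔`-bounded sums of truncations
  (`DirichletForm.exists_sq`, `DirichletForm.mem_domain_of_tendsto`).
-/

noncomputable section

/-! ### Continuous functional calculus for a positive contraction on a real Hilbert space -/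

section FunctionalCalculus

open Polynomial

/-- The finite-dimensional case, by diagonalization. -/
theorem LinearMap.IsSymmetric.norm_aeval_le {V : Type*} [NormedAddCommGroup V]
    [InnerProductSpace ℝ V] [FiniteDimensional ℝ V] {S : V →ₗ[ℝ] V} (hS : S.IsSymmetric)
    (h0 : ∀ x, 0 ≤ inner ℝ (S x) x) (h1 : ∀ x, inner ℝ (S x) x ≤ ‖x‖ ^ 2) {p : ℝ[X]} {M : ℝ}
    (hM : ∀ r ∈ Set.Icc (0 : ℝ) 1, |p.eval r| ≤ M) (x : V) :
    ‖aeval S p x‖ ≤ M * ‖x‖ := by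
  set b := hS.eigenvectorBasis rfl
  set μ := hS.eigenvalues rfl
  have hb : ∀ i v, b.repr (S v) i = μ i * b.repr v i := fun i v =>
    hS.eigenvectorBasis_apply_self_apply rfl v i
  have hμ : ∀ i, μ i ∈ Set.Icc (0 : ℝ) 1 := fun i => by
    have h : S (b i) = μ i • b i := hS.apply_eigenvectorBasis rfl i
    have h2 := h0 (b i)
    have h3 := h1 (b i)
    rw [h, real_inner_smul_left, real_inner_self_eq_norm_sq, b.norm_eq_one] at h2 h3
    constructor <;> linarith
  have hp : ∀ (q : ℝ[X]) i v, b.repr (aeval S q v) i = q.eval (μ i) * b.repr v i := by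
    intro q i
    induction q using Polynomial.induction_on' with
    | add q r hq hr => intro v; simp [hq, hr, add_mul]
    | monomial n a =>
      have : ∀ n v, b.repr ((S ^ n) v) i = μ i ^ n * b.repr v i := by
        intro n
        induction n with
        | zero => simp
        | succ n ih => intro v; rw [pow_succ, Module.End.mul_apply, ih, hb]; ring
      intro v
      simp [aeval_monomial, this, Module.algebraMap_end_apply, mul_assoc]
  have hM0 : 0 ≤ M := (abs_nonneg _).trans (hM 0 (by simp))
  refine le_of_sq_le_sq ?_ (by positivity)
  -- In coordinates, `p(S)` multiplies by `p(μ i)` and `μ i ∈ [0, 1]`.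
  rw [← b.repr.norm_map (aeval S p x), ← b.repr.norm_map x, mul_pow, EuclideanSpace.norm_sq_eq,
    EuclideanSpace.norm_sq_eq, Finset.mul_sum]
  refine Finset.sum_le_sum fun i _ => ?_
  rw [hp, norm_mul, mul_pow]
  gcongr
  exact hM _ (hμ i)

variable {H : Type*} [NormedAddCommGroup H] [InnerProductSpace ℝ H]

/-- A symmetric operator whose quadratic form lies between `0` and the square of the norm. -/
structure IsPositiveContraction (R : H →L[ℝ] H) : Prop where
  symm : ∀ x y, inner ℝ (R x) y = inner ℝ x (R y)
  nonneg : ∀ x, 0 ≤ inner ℝ (R x) x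
  le_one : ∀ x, inner ℝ (R x) x ≤ ‖x‖ ^ 2

/-- Only finitely many powers of `R` are applied to the given vector `x`, so `R` can be compressed
to the Krylov space of `x`, which is finite-dimensional. -/
theorem IsPositiveContraction.norm_aeval_le {R : H →L[ℝ] H} (hR : IsPositiveContraction R)
    {p : ℝ[X]} {M : ℝ} (hM : ∀ r ∈ Set.Icc (0 : ℝ) 1, |p.eval r| ≤ M) :
    ‖aeval R p‖ ≤ M := by
  have hM0 : 0 ≤ M := (abs_nonneg _).trans (hM 0 (by simp))
  refine ContinuousLinearMap.opNorm_le_bound _ hM0 fun x => ?_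
  let K : Submodule ℝ H :=
    Submodule.span ℝ (Set.range fun j : Fin (p.natDegree + 1) => (R ^ (j : ℕ)) x)
  have hK : ∀ j ≤ p.natDegree, (R ^ j) x ∈ K := fun j hj =>
    Submodule.subset_span ⟨⟨j, by omega⟩, rfl⟩
  have : FiniteDimensional ℝ K := FiniteDimensional.span_of_finite ℝ (Set.finite_range _)
  let S : K →ₗ[ℝ] K :=
    ((K.orthogonalProjectionOnto ∘L R) ∘L K.subtypeL : K →L[ℝ] K)
  have hSapply : ∀ y : K, S y = K.orthogonalProjectionOnto (R y) := fun y => rfl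
  have hSi : ∀ y z : K, inner ℝ (S y) z = inner ℝ (R y) (z : H) := fun y z => by
    rw [hSapply, Submodule.inner_orthogonalProjectionOnto_eq_of_mem_right]
  have hSsymm : S.IsSymmetric := fun y z => by
    rw [hSi, hR.symm, real_inner_comm, ← hSi, real_inner_comm]
  have hpow : ∀ j (hj : j ≤ p.natDegree), (S ^ j) ⟨x, by simpa using hK 0 (Nat.zero_le _)⟩
      = ⟨(R ^ j) x, hK j hj⟩ := by
    intro j
    induction j with
    | zero => intro _; simp
    | succ j ih =>
      intro hj
      rw [pow_succ', Module.End.mul_apply, ih (by omega), hSapply]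
      have : R ((R ^ j) x) = (R ^ (j + 1)) x := by
        rw [pow_succ']; rfl
      simp only [this]
      exact Submodule.orthogonalProjectionOnto_mem_subspace_eq_self (K := K) ⟨_, hK _ hj⟩
  have hval : ((aeval S p ⟨x, by simpa using hK 0 (Nat.zero_le _)⟩ : K) : H) = aeval R p x := by
    rw [aeval_eq_sum_range, aeval_eq_sum_range]
    simp only [LinearMap.sum_apply, LinearMap.smul_apply, sum_apply,
      smul_apply, Submodule.coe_sum, Submodule.coe_smul]
    refine Finset.sum_congr rfl fun j hj => ?_
    rw [hpow j (by simpa [Nat.lt_succ_iff] using hj)]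
  rw [← hval]
  exact hSsymm.norm_aeval_le (fun y => by rw [hSi]; exact hR.nonneg y)
    (fun y => by rw [hSi]; exact hR.le_one y) hM _

theorem IsPositiveContraction.inner_aeval {R : H →L[ℝ] H} (hR : IsPositiveContraction R)
    (p : ℝ[X]) (x y : H) : inner ℝ (aeval R p x) y = inner ℝ x (aeval R p y) := by
  induction p using Polynomial.induction_on' with
  | add q r hq hr => simp [inner_add_left, inner_add_right, hq, hr]
  | monomial n a =>
    have : ∀ n x y, inner ℝ ((R ^ n) x) y = inner ℝ x ((R ^ n) y) := by
      intro n
      induction n with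
      | zero => simp
      | succ n ih =>
        intro x y
        rw [pow_succ, mul_apply_eq_comp, ih, hR.symm, ← mul_apply_eq_comp,
          ← pow_succ', pow_succ]
    rw [aeval_monomial, Algebra.algebraMap_eq_smul_one, smul_mul_assoc, one_mul,
      smul_apply, smul_apply, real_inner_smul_left,
      real_inner_smul_right, this]

theorem exists_tendsto_polynomial (f : C(unitInterval, ℝ)) : ∃ q : ℕ → ℝ[X],
    Tendsto (fun n => (q n).toContinuousMapOn unitInterval) atTop (𝓝 f) := by
  choose q hq using fun n : ℕ =>
    exists_polynomial_near_continuousMap 0 1 f (1 / ((n : ℝ) + 1)) (by positivity)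
  refine ⟨q, ?_⟩
  rw [tendsto_iff_norm_sub_tendsto_zero]
  exact squeeze_zero (fun n => norm_nonneg _) (fun n => (hq n).le)
    tendsto_one_div_add_atTop_nhds_zero_nat

namespace IsPositiveContraction

variable [CompleteSpace H] {R : H →L[ℝ] H}

theorem exists_limit (hR : IsPositiveContraction R) (f : C(unitInterval, ℝ)) :
    ∃ A : H →L[ℝ] H, ∀ p : ℝ[X], ‖aeval R p - A‖ ≤ ‖p.toContinuousMapOn unitInterval - f‖ := by
  have hpq : ∀ p q : ℝ[X], ‖aeval R p - aeval R q‖ ≤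
      ‖p.toContinuousMapOn unitInterval - q.toContinuousMapOn unitInterval‖ := fun p q => by
    rw [← map_sub]
    refine hR.norm_aeval_le fun r hr => ?_
    simpa using (p.toContinuousMapOn unitInterval
      - q.toContinuousMapOn unitInterval).norm_coe_le_norm ⟨r, hr⟩
  obtain ⟨q, hlim⟩ := exists_tendsto_polynomial f
  have hc : CauchySeq fun n => aeval R (q n) := by
    refine Metric.cauchySeq_iff.2 fun δ hδ => ?_
    obtain ⟨N, hN⟩ := Metric.cauchySeq_iff.1 hlim.cauchySeq δ hδ
    refine ⟨N, fun j hj k hk => lt_of_le_of_lt ?_ (hN j hj k hk)⟩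
    rw [dist_eq_norm, dist_eq_norm]
    exact hpq _ _
  obtain ⟨A, hA⟩ := cauchySeq_tendsto_of_complete hc
  exact ⟨A, fun p => le_of_tendsto_of_tendsto' (hA.const_sub _).norm (hlim.const_sub _).norm
    fun n => hpq _ _⟩

theorem tendsto_aeval_choose (hR : IsPositiveContraction R) {f : C(unitInterval, ℝ)}
    {q : ℕ → ℝ[X]}
    (hq : Tendsto (fun n => (q n).toContinuousMapOn unitInterval) atTop (𝓝 f)) :
    Tendsto (fun n => aeval R (q n)) atTop (𝓝 (hR.exists_limit f).choose) := by
  rw [tendsto_iff_norm_sub_tendsto_zero] at hq ⊢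
  exact squeeze_zero (fun n => norm_nonneg _) (fun n => (hR.exists_limit f).choose_spec _) hq

/-- The functional calculus `f ↦ f(R)` of a positive contraction `R`, where `f(R)` is the limit of
`p(R)` for polynomials `p` tending to `f` uniformly on `[0, 1]`. -/
def fc (hR : IsPositiveContraction R) : C(unitInterval, ℝ) →ₐ[ℝ] (H →L[ℝ] H) :=
  AlgHom.ofLinearMap
    { toFun := fun f => (hR.exists_limit f).choose
      map_add' := fun f g => by
        obtain ⟨q, hq⟩ := exists_tendsto_polynomial f
        obtain ⟨r, hr⟩ := exists_tendsto_polynomial g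
        have h : Tendsto (fun n => (q n + r n).toContinuousMapOn unitInterval) atTop
            (𝓝 (f + g)) := (hq.add hr).congr fun n => by ext; simp
        refine tendsto_nhds_unique (hR.tendsto_aeval_choose h) ?_
        simpa using (hR.tendsto_aeval_choose hq).add (hR.tendsto_aeval_choose hr)
      map_smul' := fun c f => by
        obtain ⟨q, hq⟩ := exists_tendsto_polynomial f
        have h : Tendsto (fun n => (c • q n).toContinuousMapOn unitInterval) atTop
            (𝓝 (c • f)) := (hq.const_smul c).congr fun n => by ext; simp
        refine tendsto_nhds_unique (hR.tendsto_aeval_choose h) ?_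
        simpa using (hR.tendsto_aeval_choose hq).const_smul c }
    (by
      have h : Tendsto (fun _ : ℕ => (1 : ℝ[X]).toContinuousMapOn unitInterval) atTop (𝓝 1) :=
        tendsto_const_nhds.congr fun n => by ext; simp
      refine tendsto_nhds_unique (hR.tendsto_aeval_choose h) ?_
      simp)
    (fun f g => by
      obtain ⟨q, hq⟩ := exists_tendsto_polynomial f
      obtain ⟨r, hr⟩ := exists_tendsto_polynomial g
      have h : Tendsto (fun n => (q n * r n).toContinuousMapOn unitInterval) atTop
          (𝓝 (f * g)) := (hq.mul hr).congr fun n => by ext; simp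
      refine tendsto_nhds_unique (hR.tendsto_aeval_choose h) ?_
      simpa using (hR.tendsto_aeval_choose hq).mul (hR.tendsto_aeval_choose hr))

theorem tendsto_aeval (hR : IsPositiveContraction R) {f : C(unitInterval, ℝ)} {q : ℕ → ℝ[X]}
    (hq : Tendsto (fun n => (q n).toContinuousMapOn unitInterval) atTop (𝓝 f)) :
    Tendsto (fun n => aeval R (q n)) atTop (𝓝 (hR.fc f)) :=
  hR.tendsto_aeval_choose hq

theorem fc_polynomial (hR : IsPositiveContraction R) (p : ℝ[X]) :
    hR.fc (p.toContinuousMapOn unitInterval) = aeval R p :=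
  (tendsto_nhds_unique (hR.tendsto_aeval (q := fun _ => p) tendsto_const_nhds)
    tendsto_const_nhds)

theorem norm_fc_le (hR : IsPositiveContraction R) (f : C(unitInterval, ℝ)) :
    ‖hR.fc f‖ ≤ ‖f‖ := by
  have h := (hR.exists_limit f).choose_spec 0
  rw [show (0 : ℝ[X]).toContinuousMapOn unitInterval = 0 by ext; simp, map_zero, zero_sub,
    zero_sub, norm_neg, norm_neg] at h
  exact h

theorem inner_fc (hR : IsPositiveContraction R) (f : C(unitInterval, ℝ)) (x y : H) :
    inner ℝ (hR.fc f x) y = inner ℝ x (hR.fc f y) := by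
  obtain ⟨q, hq⟩ := exists_tendsto_polynomial f
  have h : ∀ z, Tendsto (fun n => aeval R (q n) z) atTop (𝓝 (hR.fc f z)) := fun z =>
    ((ContinuousLinearMap.apply ℝ H z).continuous.tendsto _).comp (hR.tendsto_aeval hq)
  refine tendsto_nhds_unique ((h x).inner tendsto_const_nhds) ?_
  exact (tendsto_const_nhds.inner (h y)).congr fun n => (hR.inner_aeval _ _ _).symm

/-- The functional calculus applied to a fixed vector, as a continuous linear map. -/
def fcApply (hR : IsPositiveContraction R) (x : H) : C(unitInterval, ℝ) →L[ℝ] H :=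
  (ContinuousLinearMap.apply ℝ H x) ∘L (hR.fc.toLinearMap.mkContinuous 1 fun f => by
    simpa using hR.norm_fc_le f)

theorem fcApply_apply (hR : IsPositiveContraction R) (x : H) (f : C(unitInterval, ℝ)) :
    hR.fcApply x f = hR.fc f x := rfl

theorem continuous_fc (hR : IsPositiveContraction R) : Continuous hR.fc :=
  (hR.fc.toLinearMap.mkContinuous 1 fun f => by simpa using hR.norm_fc_le f).continuous

theorem exp_fc (hR : IsPositiveContraction R) (f : C(unitInterval, ℝ)) :
    NormedSpace.exp (hR.fc f) = hR.fc (NormedSpace.exp f) :=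
  (NormedSpace.map_exp_of_mem_ball (𝕂 := ℝ) hR.fc hR.continuous_fc f
    ((NormedSpace.expSeries_radius_eq_top ℝ C(unitInterval, ℝ)).symm ▸ edist_lt_top _ _)).symm

end IsPositiveContraction

end FunctionalCalculus

theorem ContinuousMap.exp_apply (f : C(unitInterval, ℝ)) (r : unitInterval) :
    NormedSpace.exp f r = Real.exp (f r) := by
  rw [Real.exp_eq_exp_ℝ]
  exact NormedSpace.map_exp_of_mem_ball (𝕂 := ℝ) (ContinuousMap.evalAlgHom ℝ ℝ r)
    (ContinuousMap.evalCLM ℝ r).continuous f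
    ((NormedSpace.expSeries_radius_eq_top ℝ C(unitInterval, ℝ)).symm ▸ edist_lt_top _ _)

/-! ### Functions on the half-line as functions of `r = 1 / (1 + x)` -/

/-- A function that is continuous on `[0, ∞)` and tends to `0` at infinity. -/
structure Decays (φ : ℝ → ℝ) : Prop where
  continuousOn : ContinuousOn φ (Set.Ici 0)
  tendsto : Tendsto φ atTop (𝓝 0)

/-- The point `1 / (1 + x)` of `[0, 1]`. (Only used for `x ≥ 0`.) -/
def resolventPoint (x : ℝ) : unitInterval := Set.projIcc 0 1 zero_le_one (1 + x)⁻¹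

theorem coe_resolventPoint {x : ℝ} (hx : 0 ≤ x) : (resolventPoint x : ℝ) = (1 + x)⁻¹ := by
  rw [resolventPoint, Set.projIcc_of_mem]
  exact ⟨by positivity, inv_le_one_of_one_le₀ (by linarith)⟩

theorem resolventPoint_ne_zero {x : ℝ} (hx : 0 ≤ x) : resolventPoint x ≠ 0 := fun h => by
  have := congrArg Subtype.val h
  rw [coe_resolventPoint hx] at this
  exact (inv_pos.2 (by linarith : 0 < 1 + x)).ne' this

theorem eq_zero_or_eq_resolventPoint (r : unitInterval) :
    r = 0 ∨ ∃ x, 0 ≤ x ∧ r = resolventPoint x := by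
  rcases eq_or_ne r 0 with h | h
  · exact Or.inl h
  · have hr : 0 < (r : ℝ) := unitInterval.pos_iff_ne_zero.2 h
    have h1 : 0 ≤ (r : ℝ)⁻¹ - 1 := sub_nonneg.2 ((one_le_inv₀ hr).2 r.2.2)
    refine Or.inr ⟨(r : ℝ)⁻¹ - 1, h1, Subtype.ext ?_⟩
    rw [coe_resolventPoint h1]
    simp

theorem Decays.continuous_ite {φ : ℝ → ℝ} (h : Decays φ) :
    Continuous fun r : unitInterval => if r = 0 then 0 else φ ((r : ℝ)⁻¹ - 1) := by
  rw [continuous_iff_continuousAt]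
  intro r
  have hmem : ∀ s : unitInterval, s ≠ 0 → (s : ℝ)⁻¹ - 1 ∈ Set.Ici (0 : ℝ) := fun s hs =>
    sub_nonneg.2 ((one_le_inv₀ (unitInterval.pos_iff_ne_zero.2 hs)).2 s.2.2)
  rcases eq_or_ne r 0 with rfl | hr
  · rw [continuousAt_iff_punctured_nhds, if_pos rfl]
    have h1 : Tendsto (fun s : unitInterval => (s : ℝ)) (𝓝[≠] 0) (𝓝[>] 0) :=
      tendsto_nhdsWithin_iff.2 ⟨(continuous_subtype_val.tendsto' _ _ rfl).mono_left
        nhdsWithin_le_nhds, eventually_nhdsWithin_of_forall fun s hs =>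
          unitInterval.pos_iff_ne_zero.2 hs⟩
    have h2 := h.tendsto.comp
      (tendsto_atTop_add_const_right _ (-1) (tendsto_inv_nhdsGT_zero.comp h1))
    refine h2.congr' ?_
    filter_upwards [self_mem_nhdsWithin] with s hs
    exact (if_neg hs).symm
  · have h1 : Tendsto (fun s : unitInterval => (s : ℝ)⁻¹ - 1) (𝓝 r)
        (𝓝[Set.Ici 0] ((r : ℝ)⁻¹ - 1)) :=
      tendsto_nhdsWithin_iff.2
        ⟨((continuous_subtype_val.tendsto r).inv₀ (unitInterval.coe_ne_zero.2 hr)).sub_const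
          1, (eventually_ne_nhds hr).mono hmem⟩
    rw [ContinuousAt, if_neg hr]
    refine ((h.continuousOn _ (hmem r hr)).tendsto.comp h1).congr' ?_
    filter_upwards [eventually_ne_nhds hr] with s hs
    exact (if_neg hs).symm

open Classical in
/-- The function on `[0, 1]` with value `φ x` at `r = 1 / (1 + x)`, and `0` at `r = 0`. (The
junk value is `0` if this is not continuous.) -/
def ofDecay (φ : ℝ → ℝ) : C(unitInterval, ℝ) :=
  if h : Decays φ then ⟨_, h.continuous_ite⟩ else 0

theorem ofDecay_zero (φ : ℝ → ℝ) : ofDecay φ 0 = 0 := by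
  rw [ofDecay]; split_ifs <;> simp

theorem ofDecay_apply {φ : ℝ → ℝ} (h : Decays φ) {x : ℝ} (hx : 0 ≤ x) :
    ofDecay φ (resolventPoint x) = φ x := by
  rw [ofDecay, dif_pos h]
  simp [resolventPoint_ne_zero hx, coe_resolventPoint hx]

theorem ContinuousMap.ext_resolventPoint {f g : C(unitInterval, ℝ)} (h0 : f 0 = g 0)
    (h : ∀ x, 0 ≤ x → f (resolventPoint x) = g (resolventPoint x)) : f = g := by
  ext r
  obtain rfl | ⟨x, hx, rfl⟩ := eq_zero_or_eq_resolventPoint r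
  · exact h0
  · exact h x hx

theorem ContinuousMap.norm_le_resolventPoint {f : C(unitInterval, ℝ)} {c : ℝ} (h0 : |f 0| ≤ c)
    (h : ∀ x, 0 ≤ x → |f (resolventPoint x)| ≤ c) : ‖f‖ ≤ c := by
  refine (ContinuousMap.norm_le _ ((abs_nonneg _).trans h0)).2 fun r => ?_
  obtain rfl | ⟨x, hx, rfl⟩ := eq_zero_or_eq_resolventPoint r
  · exact h0
  · exact h x hx

theorem decays_exp {t : ℝ} (ht : 0 < t) : Decays fun x => Real.exp (-(t * x)) :=
  ⟨by fun_prop, Real.tendsto_exp_neg_atTop_nhds_zero.comp (tendsto_id.const_mul_atTop ht)⟩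

theorem decays_inv {l : ℝ} (hl : 0 < l) : Decays fun x => (l + x)⁻¹ :=
  ⟨ContinuousOn.inv₀ (by fun_prop) fun x hx => by
      have : (0 : ℝ) ≤ x := hx
      positivity,
    tendsto_inv_atTop_zero.comp (tendsto_atTop_add_const_left _ _ tendsto_id)⟩

theorem decays_rpow_mul_exp {γ : ℝ} (hγ : 0 < γ) : Decays fun x => x ^ γ * Real.exp (-x) :=
  ⟨((Real.continuous_rpow_const hγ.le).mul (by fun_prop)).continuousOn,
    by simpa using tendsto_rpow_mul_exp_neg_mul_atTop_nhds_zero γ 1 one_pos⟩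

theorem decays_rpow_mul_inv {γ l : ℝ} (hγ : 0 < γ) (hγ1 : γ < 1) (hl : 0 < l) :
    Decays fun x => x ^ γ * (l + x)⁻¹ := by
  refine ⟨(Real.continuous_rpow_const hγ.le).continuousOn.mul (decays_inv hl).continuousOn, ?_⟩
  refine squeeze_zero' (g := fun x : ℝ => x ^ (-(1 - γ))) ?_ ?_
    (tendsto_rpow_neg_atTop (by linarith))
  · filter_upwards [eventually_gt_atTop 0] with x hx
    positivity
  · filter_upwards [eventually_gt_atTop 0] with x hx
    rw [show -(1 - γ) = γ + -1 by ring, Real.rpow_add hx, Real.rpow_neg_one]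
    gcongr
    linarith

/-- The function `x ↦ e^{-tx}`, for `t > 0`. -/
def expFn (t : ℝ) : C(unitInterval, ℝ) := ofDecay fun x => Real.exp (-(t * x))

/-- The function `x ↦ (l + x)⁻¹`, for `l > 0`. -/
def invFn (l : ℝ) : C(unitInterval, ℝ) := ofDecay fun x => (l + x)⁻¹

/-- The function `x ↦ x ^ γ * e^{-x}`, for `γ > 0`. -/
def rpowExpFn (γ : ℝ) : C(unitInterval, ℝ) := ofDecay fun x => x ^ γ * Real.exp (-x)

/-- The function `x ↦ x ^ γ / (l + x)`, for `0 < γ < 1` and `l > 0`. -/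
def rpowInvFn (γ l : ℝ) : C(unitInterval, ℝ) := ofDecay fun x => x ^ γ * (l + x)⁻¹

theorem expFn_zero (t : ℝ) : expFn t 0 = 0 := ofDecay_zero _
theorem invFn_zero (l : ℝ) : invFn l 0 = 0 := ofDecay_zero _
theorem rpowExpFn_zero (γ : ℝ) : rpowExpFn γ 0 = 0 := ofDecay_zero _
theorem rpowInvFn_zero (γ l : ℝ) : rpowInvFn γ l 0 = 0 := ofDecay_zero _

theorem expFn_apply {t x : ℝ} (ht : 0 < t) (hx : 0 ≤ x) :
    expFn t (resolventPoint x) = Real.exp (-(t * x)) := ofDecay_apply (decays_exp ht) hx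
theorem invFn_apply {l x : ℝ} (hl : 0 < l) (hx : 0 ≤ x) :
    invFn l (resolventPoint x) = (l + x)⁻¹ := ofDecay_apply (decays_inv hl) hx
theorem rpowExpFn_apply {γ x : ℝ} (hγ : 0 < γ) (hx : 0 ≤ x) :
    rpowExpFn γ (resolventPoint x) = x ^ γ * Real.exp (-x) :=
  ofDecay_apply (decays_rpow_mul_exp hγ) hx
theorem rpowInvFn_apply {γ l x : ℝ} (hγ : 0 < γ) (hγ1 : γ < 1) (hl : 0 < l) (hx : 0 ≤ x) :
    rpowInvFn γ l (resolventPoint x) = x ^ γ * (l + x)⁻¹ :=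
  ofDecay_apply (decays_rpow_mul_inv hγ hγ1 hl) hx

theorem invFn_one : invFn 1 = (Polynomial.X : Polynomial ℝ).toContinuousMapOn unitInterval :=
  ContinuousMap.ext_resolventPoint (by simp [invFn_zero]) fun x hx => by
    simp [invFn_apply one_pos hx, coe_resolventPoint hx]

/-- The resolvent identity between `l` and `1`. -/
theorem invFn_eq {l : ℝ} (hl : 0 < l) :
    invFn l = invFn 1 * (1 + (1 - l) • invFn l) :=
  ContinuousMap.ext_resolventPoint (by simp [invFn_zero]) fun x hx => by
    simp only [ContinuousMap.mul_apply, ContinuousMap.add_apply, ContinuousMap.one_apply,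
      ContinuousMap.smul_apply, invFn_apply one_pos hx, invFn_apply hl hx, smul_eq_mul]
    field_simp
    ring

theorem expFn_mul_expFn {s t : ℝ} (hs : 0 < s) (ht : 0 < t) :
    expFn s * expFn t = expFn (s + t) :=
  ContinuousMap.ext_resolventPoint (by simp [expFn_zero]) fun x hx => by
    rw [ContinuousMap.mul_apply, expFn_apply hs hx, expFn_apply ht hx,
      expFn_apply (add_pos hs ht) hx, ← Real.exp_add]
    ring_nf

theorem expFn_mul_rpowInvFn {γ l : ℝ} (hγ : 0 < γ) (hγ1 : γ < 1) (hl : 0 < l) :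
    expFn 1 * rpowInvFn γ l = invFn l * rpowExpFn γ :=
  ContinuousMap.ext_resolventPoint (by simp [expFn_zero, invFn_zero]) fun x hx => by
    rw [ContinuousMap.mul_apply, ContinuousMap.mul_apply, expFn_apply one_pos hx,
      rpowInvFn_apply hγ hγ1 hl hx, invFn_apply hl hx, rpowExpFn_apply hγ hx, one_mul]
    ring

theorem mul_exp_neg_le (x : ℝ) : x * Real.exp (-x) ≤ 1 := by
  rw [Real.exp_neg, mul_inv_le_iff₀ (Real.exp_pos x), one_mul]
  linarith [Real.add_one_le_exp x]

theorem norm_smul_invFn_mul_rpowExpFn_le {γ l : ℝ} (hγ : 0 < γ) (hγ1 : γ < 1) (hl : 0 < l) :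
    ‖(l • invFn l) * rpowExpFn γ‖ ≤ l ^ γ := by
  refine ContinuousMap.norm_le_resolventPoint ?_ fun x hx => ?_
  · simp only [ContinuousMap.mul_apply, rpowExpFn_zero, mul_zero, abs_zero]
    positivity
  · rw [ContinuousMap.mul_apply, ContinuousMap.smul_apply, invFn_apply hl hx,
      rpowExpFn_apply hγ hx, smul_eq_mul, abs_of_nonneg (by positivity)]
    have h1 : l ^ (1 - γ) * x ^ γ ≤ l + x := by
      have := Real.geom_mean_le_arith_mean2_weighted (sub_nonneg.2 hγ1.le) hγ.le hl.le hx (by ring)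
      nlinarith
    have h2 : Real.exp (-x) ≤ 1 := Real.exp_le_one_iff.2 (by linarith)
    have h3 : l = l ^ γ * l ^ (1 - γ) := by
      rw [← Real.rpow_add hl]; simp
    calc l * (l + x)⁻¹ * (x ^ γ * Real.exp (-x))
        ≤ l * (l + x)⁻¹ * (x ^ γ * 1) := by gcongr
      _ = l ^ γ * ((l ^ (1 - γ) * x ^ γ) * (l + x)⁻¹) := by
          nth_rewrite 1 [h3]; ring
      _ ≤ l ^ γ * 1 := by
          gcongr
          rw [mul_inv_le_iff₀ (by positivity), one_mul]
          exact h1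
      _ = l ^ γ := mul_one _

/-- The Yosida approximation of `x` is `l x / (l + x) = l (1 - l / (l + x))`. -/
theorem norm_exp_yosida_sub_expFn_le {t l : ℝ} (ht : 0 < t) (hl : 0 < l) :
    ‖NormedSpace.exp (-(t * l) • (1 - l • invFn l)) - expFn t‖ ≤ 8 / (t * l) := by
  have key : ∀ y, 0 < y → Real.exp (-y) ≤ 1 / y := fun y hy => by
    rw [le_div_iff₀ hy, mul_comm]
    exact mul_exp_neg_le y
  refine ContinuousMap.norm_le_resolventPoint ?_ fun x hx => ?_
  · simp only [ContinuousMap.sub_apply, ContinuousMap.exp_apply, ContinuousMap.smul_apply,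
      invFn_zero, expFn_zero, ContinuousMap.one_apply, smul_eq_mul, mul_zero, sub_zero, mul_one,
      Real.abs_exp]
    refine (key _ (by positivity)).trans ?_
    gcongr
    norm_num
  · simp only [ContinuousMap.sub_apply, ContinuousMap.exp_apply, ContinuousMap.smul_apply,
      invFn_apply hl hx, expFn_apply ht hx, ContinuousMap.one_apply, smul_eq_mul]
    set s := l * x / (l + x) with hs
    have e1 : -(t * l) * (1 - l * (l + x)⁻¹) = -(t * s) := by
      rw [hs]; field_simp; ring
    have hsx : s ≤ x := by
      rw [hs, div_le_iff₀ (by positivity)]; nlinarith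
    rw [e1, abs_of_nonneg (sub_nonneg.2 (Real.exp_le_exp.2 (by nlinarith)))]
    -- For `x ≤ l` the exponents differ by at most `t x ^ 2 / l`, and both are at least `t x / 2`;
    -- for `x ≥ l` both exponents are at least `t l / 2`.
    rcases le_total x l with h | h
    · have hs2 : x / 2 ≤ s := by
        rw [hs, div_le_div_iff₀ (by norm_num) (by positivity)]; nlinarith
      have h1 : x - s ≤ x ^ 2 / l := by
        rw [hs, sub_le_iff_le_add, div_add_div _ _ hl.ne' (by positivity),
          le_div_iff₀ (by positivity)]
        have : 0 ≤ x ^ 3 := by positivity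
        nlinarith
      have h2 : 1 - Real.exp (-(t * (x - s))) ≤ t * (x - s) := by
        linarith [Real.add_one_le_exp (-(t * (x - s)))]
      have h3 : Real.exp (-(t * s)) - Real.exp (-(t * x))
          = Real.exp (-(t * s)) * (1 - Real.exp (-(t * (x - s)))) := by
        rw [mul_sub, mul_one, ← Real.exp_add]; ring_nf
      have h4 : (t * x) ^ 2 * Real.exp (-(t * x / 2)) ≤ 8 := by
        rw [Real.exp_neg, mul_inv_le_iff₀ (Real.exp_pos _)]
        have := Real.quadratic_le_exp_of_nonneg (x := t * x / 2) (by positivity)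
        nlinarith [mul_nonneg ht.le hx]
      rw [h3]
      calc Real.exp (-(t * s)) * (1 - Real.exp (-(t * (x - s))))
          ≤ Real.exp (-(t * x / 2)) * (t * (x ^ 2 / l)) := by
            refine mul_le_mul (Real.exp_le_exp.2 (by nlinarith)) (h2.trans (by gcongr)) ?_
              (Real.exp_pos _).le
            rw [sub_nonneg, Real.exp_le_one_iff]
            nlinarith [mul_nonneg ht.le (sub_nonneg.2 hsx)]
        _ = ((t * x) ^ 2 * Real.exp (-(t * x / 2))) / (t * l) := by field_simp
        _ ≤ 8 / (t * l) := by gcongr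
    · have hs2 : l / 2 ≤ s := by
        rw [hs, div_le_div_iff₀ (by norm_num) (by positivity)]; nlinarith
      calc Real.exp (-(t * s)) - Real.exp (-(t * x)) ≤ Real.exp (-(t * l / 2)) := by
            have : Real.exp (-(t * s)) ≤ Real.exp (-(t * l / 2)) :=
              Real.exp_le_exp.2 (by nlinarith)
            linarith [Real.exp_pos (-(t * x))]
        _ ≤ 1 / (t * l / 2) := key _ (by positivity)
        _ = 2 / (t * l) := by field_simp
        _ ≤ 8 / (t * l) := by gcongr; norm_num

/-! ### Power functions as integrals of exponentials -/

theorem norm_expFn_sub_expFn_le {s t : ℝ} (hs : 0 < s) (hst : s ≤ t) :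
    ‖expFn s - expFn t‖ ≤ (t - s) / s := by
  have hd : 0 ≤ (t - s) / s := div_nonneg (sub_nonneg.2 hst) hs.le
  refine ContinuousMap.norm_le_resolventPoint (by simpa [expFn_zero] using hd) fun x hx => ?_
  rw [ContinuousMap.sub_apply, expFn_apply hs hx, expFn_apply (hs.trans_le hst) hx,
    abs_of_nonneg (sub_nonneg.2 (Real.exp_le_exp.2 (by nlinarith)))]
  have h1 : 1 - Real.exp (-((t - s) * x)) ≤ (t - s) * x := by
    linarith [Real.add_one_le_exp (-((t - s) * x))]
  have h2 : Real.exp (-(s * x)) - Real.exp (-(t * x))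
      = Real.exp (-(s * x)) * (1 - Real.exp (-((t - s) * x))) := by
    rw [mul_sub, mul_one, ← Real.exp_add]; ring_nf
  calc Real.exp (-(s * x)) - Real.exp (-(t * x))
      ≤ Real.exp (-(s * x)) * ((t - s) * x) := by rw [h2]; gcongr
    _ = (s * x * Real.exp (-(s * x))) * ((t - s) / s) := by field_simp
    _ ≤ 1 * ((t - s) / s) := by gcongr; exact mul_exp_neg_le _
    _ = (t - s) / s := one_mul _

theorem norm_expFn_le_one {t : ℝ} (ht : 0 < t) : ‖expFn t‖ ≤ 1 := by
  refine ContinuousMap.norm_le_resolventPoint (by simp [expFn_zero]) fun x hx => ?_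
  rw [expFn_apply ht hx, Real.abs_exp, Real.exp_le_one_iff, neg_nonpos]
  positivity

theorem continuousOn_expFn : ContinuousOn expFn (Set.Ioi 0) := by
  intro t (ht : 0 < t)
  refine ContinuousAt.continuousWithinAt ?_
  rw [ContinuousAt, tendsto_iff_norm_sub_tendsto_zero]
  have hlim : Tendsto (fun s : ℝ => |s - t| / min s t) (𝓝 t) (𝓝 0) := by
    have : ContinuousAt (fun s : ℝ => |s - t| / min s t) t :=
      ContinuousAt.div (by fun_prop) (by fun_prop) (by simp [ht.ne'])
    simpa [ContinuousAt] using this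
  refine squeeze_zero' (Eventually.of_forall fun _ => norm_nonneg _) ?_ hlim
  filter_upwards [eventually_gt_nhds ht] with s hs
  rcases le_total s t with h | h
  · rw [min_eq_left h, abs_sub_comm, abs_of_nonneg (sub_nonneg.2 h)]
    exact norm_expFn_sub_expFn_le hs h
  · rw [min_eq_right h, abs_of_nonneg (sub_nonneg.2 h), norm_sub_rev]
    exact norm_expFn_sub_expFn_le ht h

/-- Integrability at `0` and at `∞` with powers of different orders. -/
theorem integrableOn_Ioi_of_norm_le_rpow {V : Type*} [NormedAddCommGroup V] {F : ℝ → V}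
    {α β c d : ℝ} (hF : ContinuousOn F (Set.Ioi 0)) (hα : -1 < α) (hβ : β < -1)
    (h0 : ∀ t, 0 < t → ‖F t‖ ≤ c * t ^ α) (h1 : ∀ t, 0 < t → ‖F t‖ ≤ d * t ^ β) :
    IntegrableOn F (Set.Ioi 0) := by
  have hm : AEStronglyMeasurable F (volume.restrict (Set.Ioi 0)) :=
    hF.aestronglyMeasurable_of_isSeparable measurableSet_Ioi
      (TopologicalSpace.IsSeparable.of_separableSpace _)
  rw [← Set.Ioc_union_Ioi_eq_Ioi (zero_le_one' ℝ)]
  refine IntegrableOn.union ?_ ?_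
  · refine Integrable.mono' (g := fun t => c * t ^ α) ?_
      (hm.mono_measure (Measure.restrict_mono Set.Ioc_subset_Ioi_self le_rfl)) ?_
    · exact Integrable.const_mul ((intervalIntegrable_iff_integrableOn_Ioc_of_le zero_le_one).1
        (intervalIntegral.intervalIntegrable_rpow' hα)) _
    · exact (ae_restrict_mem measurableSet_Ioc).mono fun t ht => h0 t ht.1
  · refine Integrable.mono' (g := fun t => d * t ^ β) ?_
      (hm.mono_measure (Measure.restrict_mono (Set.Ioi_subset_Ioi zero_le_one) le_rfl)) ?_
    · exact Integrable.const_mul (integrableOn_Ioi_rpow_of_lt hβ one_pos) _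
    · exact (ae_restrict_mem measurableSet_Ioi).mono fun t ht => h1 t (one_pos.trans ht)

/-- Integration by parts in the integral that defines `Γ(1 - γ)`. -/
theorem integral_one_sub_exp_neg_mul_rpow {γ : ℝ} (hγ : 0 < γ) (hγ1 : γ < 1) :
    ∫ t in Set.Ioi (0 : ℝ), (1 - Real.exp (-t)) * t ^ (-1 - γ) = Real.Gamma (1 - γ) / γ := by
  have hle : ∀ t, 0 < t → 1 - Real.exp (-t) ≤ t := fun t _ => by
    linarith [Real.add_one_le_exp (-t)]
  have hle1 : ∀ t, 0 < t → 1 - Real.exp (-t) ≤ 1 := fun t _ => by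
    linarith [Real.exp_pos (-t)]
  have hnn : ∀ t, 0 < t → 0 ≤ 1 - Real.exp (-t) := fun t ht => by
    rw [sub_nonneg, Real.exp_le_one_iff]; linarith
  have hGamma := Real.Gamma_eq_integral (sub_pos.2 hγ1)
  have hGint := Real.GammaIntegral_convergent (sub_pos.2 hγ1)
  have e : (1 - γ) - 1 = -γ := by ring
  rw [e] at hGamma hGint
  have hv : ∀ t ∈ Set.Ioi (0 : ℝ),
      HasDerivAt (fun t : ℝ => -(γ⁻¹ * t ^ (-γ))) (t ^ (-1 - γ)) t := fun t ht => by
    have h := ((Real.hasDerivAt_rpow_const (p := -γ) (Or.inl (ne_of_gt ht))).const_mul γ⁻¹).neg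
    convert! h using 1
    rw [show -γ - 1 = -1 - γ by ring]
    field_simp
  have hu : ∀ t ∈ Set.Ioi (0 : ℝ),
      HasDerivAt (fun t : ℝ => 1 - Real.exp (-t)) (Real.exp (-t)) t := fun t _ => by
    simpa using ((hasDerivAt_id t).neg.exp).const_sub 1
  have h := integral_Ioi_mul_deriv_eq_deriv_mul (a' := 0) (b' := 0) hu hv ?_ ?_ ?_ ?_
  · rw [h, hGamma, div_eq_inv_mul, ← integral_const_mul]
    rw [sub_self, zero_sub, ← integral_neg]
    refine integral_congr_ae (Eventually.of_forall fun t => ?_)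
    simp only
    ring
  · refine integrableOn_Ioi_of_norm_le_rpow (α := -γ) (β := -1 - γ) (c := 1) (d := 1) ?_
      (by linarith) (by linarith) (fun t ht => ?_) (fun t ht => ?_)
    · exact ContinuousOn.mul (by fun_prop) fun t ht =>
        (Real.continuousAt_rpow_const _ _ (Or.inl (ne_of_gt ht))).continuousWithinAt
    · rw [Pi.mul_apply, Real.norm_of_nonneg (mul_nonneg (hnn t ht) (by positivity)), one_mul]
      calc (1 - Real.exp (-t)) * t ^ (-1 - γ) ≤ t * t ^ (-1 - γ) := by
            gcongr; exact hle t ht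
        _ = t ^ (-γ) := by
            nth_rewrite 1 [← Real.rpow_one t]
            rw [← Real.rpow_add ht]; ring_nf
    · rw [Pi.mul_apply, Real.norm_of_nonneg (mul_nonneg (hnn t ht) (by positivity))]
      gcongr
      exact hle1 t ht
  · refine (hGint.const_mul (-γ⁻¹)).congr (Eventually.of_forall fun t => ?_)
    simp only [Pi.mul_apply]
    ring
  · have h0 : Tendsto (fun t : ℝ => γ⁻¹ * t ^ (1 - γ)) (𝓝[>] 0) (𝓝 0) := by
      have := (Real.continuousAt_rpow_const 0 (1 - γ) (Or.inr (by linarith))).tendsto.const_mul γ⁻¹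
      rw [Real.zero_rpow (by linarith), mul_zero] at this
      exact this.mono_left nhdsWithin_le_nhds
    refine squeeze_zero_norm' ?_ h0
    filter_upwards [self_mem_nhdsWithin] with t ht
    have ht : 0 < t := ht
    rw [Pi.mul_apply, norm_mul, norm_neg, Real.norm_of_nonneg (hnn t ht),
      Real.norm_of_nonneg (by positivity)]
    calc (1 - Real.exp (-t)) * (γ⁻¹ * t ^ (-γ)) ≤ t * (γ⁻¹ * t ^ (-γ)) := by
          gcongr; exact hle t ht
      _ = γ⁻¹ * (t ^ (1 : ℝ) * t ^ (-γ)) := by rw [Real.rpow_one]; ring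
      _ = γ⁻¹ * t ^ (1 - γ) := by rw [← Real.rpow_add ht]; ring_nf
  · have h0 : Tendsto (fun t : ℝ => γ⁻¹ * t ^ (-γ)) atTop (𝓝 0) := by
      simpa using (tendsto_rpow_neg_atTop hγ).const_mul γ⁻¹
    refine squeeze_zero_norm' ?_ h0
    filter_upwards [eventually_gt_atTop 0] with t ht
    rw [Pi.mul_apply, norm_mul, norm_neg, Real.norm_of_nonneg (hnn t ht),
      Real.norm_of_nonneg (by positivity)]
    exact mul_le_of_le_one_left (by positivity) (hle1 t ht)

theorem integral_one_sub_exp_neg_mul_mul_rpow {γ x : ℝ} (hγ : 0 < γ) (hγ1 : γ < 1) (hx : 0 ≤ x) :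
    ∫ t in Set.Ioi (0 : ℝ), (1 - Real.exp (-(t * x))) * t ^ (-1 - γ)
      = Real.Gamma (1 - γ) / γ * x ^ γ := by
  rcases hx.eq_or_lt with rfl | hx
  · simp [Real.zero_rpow hγ.ne']
  · have h := integral_comp_mul_right_Ioi
      (fun t : ℝ => (1 - Real.exp (-t)) * t ^ (-1 - γ)) 0 hx
    rw [zero_mul, integral_one_sub_exp_neg_mul_rpow hγ hγ1, smul_eq_mul] at h
    have h2 : ∫ t in Set.Ioi (0 : ℝ), (1 - Real.exp (-(t * x))) * t ^ (-1 - γ)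
        = x ^ (1 + γ) * ∫ t in Set.Ioi (0 : ℝ), (1 - Real.exp (-(t * x))) * (t * x) ^ (-1 - γ) := by
      rw [← integral_const_mul]
      refine setIntegral_congr_fun measurableSet_Ioi fun t (ht : 0 < t) => ?_
      rw [Real.mul_rpow ht.le hx.le, mul_left_comm, mul_left_comm (x ^ (1 + γ)),
        ← Real.rpow_add hx]
      simp
    rw [h2, h, ← mul_assoc, ← Real.rpow_neg_one x, ← Real.rpow_add hx, mul_comm]
    ring_nf

theorem integrableOn_smul_expFn_sub {γ : ℝ} (hγ : 0 < γ) (hγ1 : γ < 1) :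
    IntegrableOn (fun t : ℝ => (t ^ (-1 - γ) : ℝ) • (expFn 1 - expFn (1 + t))) (Set.Ioi 0) := by
  refine integrableOn_Ioi_of_norm_le_rpow (α := -γ) (β := -1 - γ) (c := 1) (d := 2) ?_
    (by linarith) (by linarith) (fun t ht => ?_) (fun t ht => ?_)
  · refine ContinuousOn.smul (fun t ht =>
        (Real.continuousAt_rpow_const _ _ (Or.inl (ne_of_gt ht))).continuousWithinAt)
      (continuousOn_const.sub (continuousOn_expFn.comp (by fun_prop) fun t (ht : 0 < t) => ?_))
    simp only [Set.mem_Ioi]; positivity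
  · rw [norm_smul, Real.norm_of_nonneg (by positivity), one_mul]
    calc t ^ (-1 - γ) * ‖expFn 1 - expFn (1 + t)‖ ≤ t ^ (-1 - γ) * ((1 + t - 1) / 1) := by
          gcongr; exact norm_expFn_sub_expFn_le one_pos (by linarith)
      _ = t ^ (-1 - γ) * t ^ (1 : ℝ) := by rw [Real.rpow_one]; ring
      _ = t ^ (-γ) := by rw [← Real.rpow_add ht]; ring_nf
  · rw [norm_smul, Real.norm_of_nonneg (by positivity), mul_comm]
    gcongr
    calc ‖expFn 1 - expFn (1 + t)‖ ≤ ‖expFn 1‖ + ‖expFn (1 + t)‖ := norm_sub_le _ _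
      _ ≤ 1 + 1 := add_le_add (norm_expFn_le_one one_pos) (norm_expFn_le_one (by positivity))
      _ = 2 := by norm_num

/-- `x ^ γ e^{-x} = γ / Γ(1 - γ) ∫₀^∞ (e^{-x} - e^{-(1 + t) x}) t^{-1 - γ} dt`, as an integral of
continuous functions. -/
theorem integral_smul_expFn_sub {γ : ℝ} (hγ : 0 < γ) (hγ1 : γ < 1) :
    (γ / Real.Gamma (1 - γ)) •
      ∫ t in Set.Ioi (0 : ℝ), (t ^ (-1 - γ) : ℝ) • (expFn 1 - expFn (1 + t)) = rpowExpFn γ := by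
  have hev : ∀ r : unitInterval,
      (∫ t in Set.Ioi (0 : ℝ), (t ^ (-1 - γ) : ℝ) • (expFn 1 - expFn (1 + t))) r
      = ∫ t in Set.Ioi (0 : ℝ), t ^ (-1 - γ) * (expFn 1 r - expFn (1 + t) r) := fun r =>
    ((ContinuousMap.evalCLM ℝ r).integral_comp_comm (integrableOn_smul_expFn_sub hγ hγ1)).symm
  refine ContinuousMap.ext_resolventPoint ?_ fun x hx => ?_
  · rw [ContinuousMap.smul_apply, hev]
    simp [expFn_zero, rpowExpFn_zero]
  · rw [ContinuousMap.smul_apply, hev, rpowExpFn_apply hγ hx]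
    have h : ∫ t in Set.Ioi (0 : ℝ), t ^ (-1 - γ) *
        (expFn 1 (resolventPoint x) - expFn (1 + t) (resolventPoint x))
        = Real.exp (-x) * ∫ t in Set.Ioi (0 : ℝ), (1 - Real.exp (-(t * x))) * t ^ (-1 - γ) := by
      rw [← integral_const_mul]
      refine setIntegral_congr_fun measurableSet_Ioi fun t (ht : 0 < t) => ?_
      rw [expFn_apply one_pos hx, expFn_apply (by positivity) hx, add_mul, one_mul, neg_add,
        Real.exp_add]
      ring
    have hG : Real.Gamma (1 - γ) ≠ 0 := (Real.Gamma_pos_of_pos (by linarith)).ne'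
    rw [h, integral_one_sub_exp_neg_mul_mul_rpow hγ hγ1 hx, smul_eq_mul]
    field_simp

theorem integrableOn_smul_expFn_mul {ε l : ℝ} (hε : 0 < ε) (hε1 : ε < 1) (hl : 0 < l) :
    IntegrableOn (fun t : ℝ => (t ^ (ε - 1) : ℝ) • (expFn t * (1 - l • invFn l)))
      (Set.Ioi 0) := by
  refine integrableOn_Ioi_of_norm_le_rpow (α := ε - 1) (β := ε - 2) (c := 1) (d := l⁻¹) ?_
    (by linarith) (by linarith) (fun t ht => ?_) (fun t ht => ?_)
  · exact ContinuousOn.smul (fun t ht =>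
        (Real.continuousAt_rpow_const _ _ (Or.inl (ne_of_gt ht))).continuousWithinAt)
      (continuousOn_expFn.mul continuousOn_const)
  · rw [norm_smul, Real.norm_of_nonneg (by positivity), mul_comm]
    gcongr
    refine ContinuousMap.norm_le_resolventPoint (by simp [expFn_zero]) fun x hx => ?_
    simp only [ContinuousMap.mul_apply, ContinuousMap.sub_apply, ContinuousMap.one_apply,
      ContinuousMap.smul_apply, invFn_apply hl hx, expFn_apply ht hx, smul_eq_mul]
    have h1 : 1 - l * (l + x)⁻¹ = x * (l + x)⁻¹ := by field_simp; ring
    rw [h1, abs_of_nonneg (by positivity)]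
    refine mul_le_one₀ (Real.exp_le_one_iff.2 (by nlinarith)) (by positivity) ?_
    rw [mul_inv_le_iff₀ (by positivity)]; linarith
  · rw [norm_smul, Real.norm_of_nonneg (by positivity)]
    have hb : ‖expFn t * (1 - l • invFn l)‖ ≤ l⁻¹ * t⁻¹ := by
      refine ContinuousMap.norm_le_resolventPoint ?_ fun x hx => ?_
      · simp only [ContinuousMap.mul_apply, expFn_zero, zero_mul, abs_zero]
        positivity
      simp only [ContinuousMap.mul_apply, ContinuousMap.sub_apply, ContinuousMap.one_apply,
        ContinuousMap.smul_apply, invFn_apply hl hx, expFn_apply ht hx, smul_eq_mul]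
      have h1 : 1 - l * (l + x)⁻¹ = x * (l + x)⁻¹ := by field_simp; ring
      rw [h1, abs_of_nonneg (by positivity)]
      calc Real.exp (-(t * x)) * (x * (l + x)⁻¹)
          ≤ Real.exp (-(t * x)) * (x * l⁻¹) := by gcongr; linarith
        _ = (t * x * Real.exp (-(t * x))) * (l⁻¹ * t⁻¹) := by field_simp
        _ ≤ 1 * (l⁻¹ * t⁻¹) := by gcongr; exact mul_exp_neg_le _
        _ = l⁻¹ * t⁻¹ := one_mul _
    calc t ^ (ε - 1) * ‖expFn t * (1 - l • invFn l)‖ ≤ t ^ (ε - 1) * (l⁻¹ * t⁻¹) := by gcongr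
      _ = l⁻¹ * (t ^ (ε - 1) * t ^ (-1 : ℝ)) := by rw [Real.rpow_neg_one]; ring
      _ = l⁻¹ * t ^ (ε - 2) := by rw [← Real.rpow_add ht]; ring_nf

/-- `x^{-ε} · x / (l + x) = 1 / Γ(ε) ∫₀^∞ e^{-tx} x / (l + x) t^{ε - 1} dt`, as an integral of
continuous functions. The factor `x / (l + x)` makes the integral converge uniformly near
`x = 0`. -/
theorem integral_smul_expFn_mul {ε l : ℝ} (hε : 0 < ε) (hε1 : ε < 1) (hl : 0 < l) :
    (Real.Gamma ε)⁻¹ •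
      ∫ t in Set.Ioi (0 : ℝ), (t ^ (ε - 1) : ℝ) • (expFn t * (1 - l • invFn l))
      = rpowInvFn (1 - ε) l := by
  have hev : ∀ r : unitInterval,
      (∫ t in Set.Ioi (0 : ℝ), (t ^ (ε - 1) : ℝ) • (expFn t * (1 - l • invFn l))) r
      = ∫ t in Set.Ioi (0 : ℝ), t ^ (ε - 1) * (expFn t r * (1 - l * invFn l r)) := fun r =>
    ((ContinuousMap.evalCLM ℝ r).integral_comp_comm (integrableOn_smul_expFn_mul hε hε1 hl)).symm
  refine ContinuousMap.ext_resolventPoint ?_ fun x hx => ?_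
  · rw [ContinuousMap.smul_apply, hev]
    simp [expFn_zero, rpowInvFn_zero]
  · rw [ContinuousMap.smul_apply, hev, rpowInvFn_apply (by linarith) (by linarith) hl hx]
    have h : ∫ t in Set.Ioi (0 : ℝ), t ^ (ε - 1) *
        (expFn t (resolventPoint x) * (1 - l * invFn l (resolventPoint x)))
        = x * (l + x)⁻¹ * ∫ t in Set.Ioi (0 : ℝ), t ^ (ε - 1) * Real.exp (-(x * t)) := by
      rw [← integral_const_mul]
      refine setIntegral_congr_fun measurableSet_Ioi fun t (ht : 0 < t) => ?_
      rw [expFn_apply ht hx, invFn_apply hl hx, mul_comm t x]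
      have h1 : 1 - l * (l + x)⁻¹ = x * (l + x)⁻¹ := by field_simp; ring
      rw [h1]
      ring
    rw [h, smul_eq_mul]
    rcases hx.eq_or_lt with rfl | hx
    · simp [Real.zero_rpow (show 1 - ε ≠ 0 by linarith)]
    · have hG : Real.Gamma ε ≠ 0 := (Real.Gamma_pos_of_pos hε).ne'
      rw [Real.integral_rpow_mul_exp_neg_mul_Ioi hε hx, one_div, Real.inv_rpow hx.le,
        ← Real.rpow_neg hx.le, sub_eq_add_neg 1 ε, Real.rpow_add hx, Real.rpow_one]
      field_simp

/-! ### Functional calculus of the generator of a Dirichlet form -/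

namespace DirichletForm

variable {X : Type*} [MeasurableSpace X] {m : Measure X}

theorem IsLaplacian.add {E : DirichletForm m} {u v g h : Lp ℝ 2 m} (hu : E.IsLaplacian u g)
    (hv : E.IsLaplacian v h) : E.IsLaplacian (u + v) (g + h) := by
  obtain ⟨hu, hu'⟩ := hu
  obtain ⟨hv, hv'⟩ := hv
  refine ⟨E.domain.add_mem hu hv, fun w => ?_⟩
  rw [inner_add_left, ← hu', ← hv', ← LinearMap.add_apply, ← map_add]
  rfl

theorem IsLaplacian.smul {E : DirichletForm m} {u g : Lp ℝ 2 m} (hu : E.IsLaplacian u g)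
    (c : ℝ) : E.IsLaplacian (c • u) (c • g) := by
  obtain ⟨hu, hu'⟩ := hu
  refine ⟨E.domain.smul_mem c hu, fun w => ?_⟩
  rw [real_inner_smul_left, ← hu', ← smul_eq_mul, ← LinearMap.smul_apply, ← map_smul]
  rfl

theorem IsLaplacian.inner_nonneg {E : DirichletForm m} {u g : Lp ℝ 2 m}
    (hu : E.IsLaplacian u g) : 0 ≤ inner ℝ g u := by
  obtain ⟨hu, hu'⟩ := hu
  rw [← hu' ⟨u, hu⟩]
  exact E.nonneg _

theorem IsLaplacian.inner_comm {E : DirichletForm m} {u v g h : Lp ℝ 2 m}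
    (hu : E.IsLaplacian u g) (hv : E.IsLaplacian v h) : inner ℝ g v = inner ℝ u h := by
  obtain ⟨hu, hu'⟩ := hu
  obtain ⟨hv, hv'⟩ := hv
  rw [real_inner_comm, real_inner_comm h, ← hv' ⟨u, hu⟩, E.symm, hu', real_inner_comm]

/-- `(l + Δ) u = f` only for `u = (l + Δ)⁻¹ f`, by positivity of `Δ`. -/
theorem IsLaplacian.eq_resolvent {E : DirichletForm m} {u f : Lp ℝ 2 m} {l : ℝ} (hl : 0 < l)
    (hu : E.IsLaplacian u (f - l • u)) : u = E.resolvent l f := by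
  have h := (hu.add ((E.isLaplacian_resolvent l hl f).smul (-1))).inner_nonneg
  have h2 : f - l • u + (-1 : ℝ) • (f - l • E.resolvent l f)
      = -(l • (u + (-1 : ℝ) • E.resolvent l f)) := by module
  rw [h2, inner_neg_left, real_inner_smul_left, real_inner_self_eq_norm_sq] at h
  have h3 : ‖u + (-1 : ℝ) • E.resolvent l f‖ ^ 2 = 0 := by
    refine le_antisymm ?_ (sq_nonneg _)
    by_contra! h4
    nlinarith
  have h4 := norm_eq_zero.1 (pow_eq_zero_iff two_ne_zero |>.1 h3)
  rwa [neg_one_smul, ← sub_eq_add_neg, sub_eq_zero] at h4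

theorem inner_resolvent (E : DirichletForm m) {l : ℝ} (hl : 0 < l) (f g : Lp ℝ 2 m) :
    inner ℝ (E.resolvent l f) g = inner ℝ f (E.resolvent l g) := by
  have h := (E.isLaplacian_resolvent l hl f).inner_comm (E.isLaplacian_resolvent l hl g)
  rw [inner_sub_left, inner_sub_right, real_inner_smul_left, real_inner_smul_right] at h
  linarith

theorem isPositiveContraction_resolvent (E : DirichletForm m) :
    IsPositiveContraction (E.resolvent 1) := by
  have h : ∀ f, ‖E.resolvent 1 f‖ ^ 2 ≤ inner ℝ (E.resolvent 1 f) f := fun f => by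
    have := (E.isLaplacian_resolvent 1 one_pos f).inner_nonneg
    rw [one_smul, inner_sub_left, real_inner_self_eq_norm_sq, real_inner_comm] at this
    linarith
  refine ⟨E.inner_resolvent one_pos, fun f => (sq_nonneg _).trans (h f), fun f => ?_⟩
  have h1 := h f
  have h2 := real_inner_le_norm (E.resolvent 1 f) f
  have h3 : ‖E.resolvent 1 f‖ ≤ ‖f‖ := by
    by_contra! h4
    nlinarith [norm_nonneg f]
  nlinarith [norm_nonneg f]

/-- The functional calculus of `Δ`: for `F ∈ C([0, 1])`, the operator `F((1 + Δ)⁻¹)`. Functions of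
`x ≥ 0` are encoded as functions of `r = 1 / (1 + x)`, by `ofDecay`. -/
def fc (E : DirichletForm m) : C(unitInterval, ℝ) →ₐ[ℝ] (Lp ℝ 2 m →L[ℝ] Lp ℝ 2 m) :=
  E.isPositiveContraction_resolvent.fc

theorem fc_mul_apply (E : DirichletForm m) (F G : C(unitInterval, ℝ)) (f : Lp ℝ 2 m) :
    E.fc (F * G) f = E.fc F (E.fc G f) := by
  rw [map_mul]; rfl

theorem inner_fc (E : DirichletForm m) (F : C(unitInterval, ℝ)) (f g : Lp ℝ 2 m) :
    inner ℝ (E.fc F f) g = inner ℝ f (E.fc F g) :=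
  E.isPositiveContraction_resolvent.inner_fc F f g

theorem norm_fc_le (E : DirichletForm m) (F : C(unitInterval, ℝ)) : ‖E.fc F‖ ≤ ‖F‖ :=
  E.isPositiveContraction_resolvent.norm_fc_le F

theorem fc_invFn_one (E : DirichletForm m) : E.fc (invFn 1) = E.resolvent 1 := by
  rw [invFn_one, fc, IsPositiveContraction.fc_polynomial, Polynomial.aeval_X]

theorem fc_invFn (E : DirichletForm m) {l : ℝ} (hl : 0 < l) :
    E.fc (invFn l) = E.resolvent l := by
  ext1 f
  refine IsLaplacian.eq_resolvent hl ?_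
  have h1 : E.fc (invFn l) f = E.resolvent 1 (f + (1 - l) • E.fc (invFn l) f) := by
    rw [← E.fc_invFn_one]
    conv_lhs => rw [invFn_eq hl, E.fc_mul_apply]
    simp
  have h2 := E.isLaplacian_resolvent 1 one_pos (f + (1 - l) • E.fc (invFn l) f)
  rw [← h1] at h2
  convert! h2 using 1
  module

/-- The Yosida approximations of the heat semigroup converge in operator norm, since `t > 0`. -/
theorem heat_eq (E : DirichletForm m) {t : ℝ} (ht : 0 < t) (f : Lp ℝ 2 m) :
    E.heat t f = E.fc (expFn t) f := by
  refine Tendsto.limUnder_eq ?_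
  have h1 : Tendsto (fun l : ℝ => NormedSpace.exp (-(t * l) • (1 - l • invFn l))) atTop
      (𝓝 (expFn t)) := by
    rw [tendsto_iff_norm_sub_tendsto_zero]
    refine squeeze_zero' (Eventually.of_forall fun _ => norm_nonneg _) ?_
      (Tendsto.const_div_atTop (tendsto_id.const_mul_atTop ht) 8)
    filter_upwards [eventually_gt_atTop 0] with l hl
    exact norm_exp_yosida_sub_expFn_le ht hl
  have h2 := ((E.isPositiveContraction_resolvent.fcApply f).continuous.tendsto _).comp h1
  refine h2.congr' ?_
  filter_upwards [eventually_gt_atTop 0] with l hl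
  have h3 : (-(t * l) • (1 - l • E.resolvent l) : Lp ℝ 2 m →L[ℝ] Lp ℝ 2 m)
      = E.fc (-(t * l) • (1 - l • invFn l)) := by
    simp [fc_invFn E hl]
  rw [h3, fc, IsPositiveContraction.exp_fc]
  rfl

/-- `Δ^γ e^{-Δ}` is a bounded operator, the function `x ^ γ e^{-x}` of `Δ`. -/
theorem isPow_heat (E : DirichletForm m) {γ : ℝ} (hγ : 0 < γ) (hγ1 : γ < 1) (f : Lp ℝ 2 m) :
    E.IsPow γ (E.heat 1 f) (E.fc (rpowExpFn γ) f) := by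
  have hint := integrableOn_smul_expFn_sub hγ hγ1
  set F : ℝ → C(unitInterval, ℝ) := fun t => (t ^ (-1 - γ) : ℝ) • (expFn 1 - expFn (1 + t))
  set L := E.isPositiveContraction_resolvent.fcApply f
  have hlim : Tendsto (fun δ : ℝ => ∫ t in Set.Ioi δ, F t) (𝓝[>] 0)
      (𝓝 (∫ t in Set.Ioi 0, F t)) := by
    refine ((aecover_Ioi_of_Ioi (μ := volume) (A := 0)
      (tendsto_id.mono_left nhdsWithin_le_nhds)).integral_tendsto_of_countably_generated
        hint).congr' ?_
    filter_upwards [self_mem_nhdsWithin] with δ hδ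
    rw [Measure.restrict_restrict_of_subset (Set.Ioi_subset_Ioi (le_of_lt hδ))]
    rfl
  have h := (L.continuous.tendsto _).comp (hlim.const_smul (γ / Real.Gamma (1 - γ)))
  rw [integral_smul_expFn_sub hγ hγ1] at h
  refine h.congr' ?_
  filter_upwards [self_mem_nhdsWithin] with δ hδ
  have hδ : 0 < δ := hδ
  rw [Function.comp_apply, map_smul,
    ← L.integral_comp_comm (hint.mono_set (Set.Ioi_subset_Ioi hδ.le))]
  congr 1
  refine setIntegral_congr_fun measurableSet_Ioi fun t (ht : δ < t) => ?_
  have ht : 0 < t := hδ.trans ht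
  simp only [F, L, map_smul, map_sub, IsPositiveContraction.fcApply_apply]
  rw [E.heat_eq one_pos, E.heat_eq ht, ← E.fc_mul_apply, expFn_mul_expFn ht one_pos, add_comm t]
  rfl

/-- The range of `Δ (l + Δ)⁻¹` is contained in the domain of `Δ^{-ε}`. -/
theorem isNegPow_sub_resolvent (E : DirichletForm m) {ε l : ℝ} (hε : 0 < ε) (hε1 : ε < 1)
    (hl : 0 < l) (g : Lp ℝ 2 m) :
    E.IsNegPow ε (g - l • E.resolvent l g) (E.fc (rpowInvFn (1 - ε) l) g) := by
  have hint := integrableOn_smul_expFn_mul hε hε1 hl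
  set F : ℝ → C(unitInterval, ℝ) := fun t => (t ^ (ε - 1) : ℝ) • (expFn t * (1 - l • invFn l))
  set L := E.isPositiveContraction_resolvent.fcApply g
  have h := (L.continuous.tendsto _).comp
    ((intervalIntegral_tendsto_integral_Ioi 0 hint tendsto_id).const_smul (Real.Gamma ε)⁻¹)
  rw [integral_smul_expFn_mul hε hε1 hl] at h
  refine h.congr' ?_
  filter_upwards [eventually_gt_atTop 0] with T hT
  rw [Function.comp_apply, map_smul, id_eq, intervalIntegral.integral_of_le hT.le,
    intervalIntegral.integral_of_le hT.le,
    ← L.integral_comp_comm (hint.mono_set Set.Ioc_subset_Ioi_self)]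
  congr 1
  refine setIntegral_congr_fun measurableSet_Ioc fun t ht => ?_
  have h1 : g - l • E.resolvent l g = E.fc (1 - l • invFn l) g := by
    simp [fc_invFn E hl]
  rw [E.heat_eq ht.1, h1, ← E.fc_mul_apply]
  simp only [F, L, map_smul, IsPositiveContraction.fcApply_apply]
  rfl

theorem heat_fc_rpowInvFn (E : DirichletForm m) {γ l : ℝ} (hγ : 0 < γ) (hγ1 : γ < 1)
    (hl : 0 < l) (g : Lp ℝ 2 m) :
    E.heat 1 (E.fc (rpowInvFn γ l) g) = E.resolvent l (E.fc (rpowExpFn γ) g) := by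
  rw [E.heat_eq one_pos, ← E.fc_mul_apply, expFn_mul_rpowInvFn hγ hγ1 hl, E.fc_mul_apply,
    E.fc_invFn hl]

/-- With `γ = 1 - ε` and `g' = g - l (l + Δ)⁻¹ g`, the function `k = e^{-Δ} Δ^{-ε} g'` is in `𝓕` and
`𝓔(k, f) = ⟨Δ^γ e^{-Δ} f, g'⟩`. -/
theorem form_heat_eq_inner (E : DirichletForm m) {γ l : ℝ} (hγ : 0 < γ) (hγ1 : γ < 1)
    (hl : 0 < l) (g : Lp ℝ 2 m) :
    ∃ k : E.domain, (k : Lp ℝ 2 m) = E.heat 1 (E.fc (rpowInvFn γ l) g) ∧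
      ∀ f : E.domain, E.form k f
        = inner ℝ (E.fc (rpowExpFn γ) (f : Lp ℝ 2 m)) (g - l • E.resolvent l g) := by
  obtain ⟨hk, hk'⟩ := E.isLaplacian_resolvent l hl (E.fc (rpowExpFn γ) g)
  refine ⟨⟨_, hk⟩, (E.heat_fc_rpowInvFn hγ hγ1 hl g).symm, fun f => ?_⟩
  have h : E.resolvent l (E.fc (rpowExpFn γ) g) = E.fc (rpowExpFn γ) (E.resolvent l g) := by
    rw [← E.fc_invFn hl, ← E.fc_mul_apply, mul_comm, E.fc_mul_apply]
  rw [hk', h, ← map_smul, ← map_sub, inner_fc, real_inner_comm]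

/-- The range of `Δ^γ` is orthogonal to the kernel of `Δ`, onto which `l (l + Δ)⁻¹` converges to the
projection as `l → 0`. -/
theorem tendsto_inner_fc_sub_resolvent (E : DirichletForm m) {γ : ℝ} (hγ : 0 < γ)
    (hγ1 : γ < 1) (f g : Lp ℝ 2 m) :
    Tendsto (fun l : ℝ => inner ℝ (E.fc (rpowExpFn γ) f) (g - l • E.resolvent l g))
      (𝓝[>] 0) (𝓝 (inner ℝ (E.fc (rpowExpFn γ) f) g)) := by
  have h0 : Tendsto (fun l : ℝ => l ^ γ * ‖f‖ * ‖g‖) (𝓝[>] 0) (𝓝 0) := by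
    have := (Real.continuousAt_rpow_const 0 γ (Or.inr hγ.le)).tendsto
    rw [Real.zero_rpow hγ.ne'] at this
    simpa using ((this.mono_left nhdsWithin_le_nhds).mul_const ‖f‖).mul_const ‖g‖
  rw [tendsto_iff_norm_sub_tendsto_zero]
  refine squeeze_zero' (Eventually.of_forall fun _ => norm_nonneg _) ?_ h0
  filter_upwards [self_mem_nhdsWithin] with l hl
  have hl : 0 < l := hl
  have h1 : inner ℝ (E.fc (rpowExpFn γ) f) (l • E.resolvent l g)
      = inner ℝ (E.fc ((l • invFn l) * rpowExpFn γ) f) g := by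
    rw [E.fc_mul_apply, map_smul, smul_apply, E.fc_invFn hl, real_inner_smul_left,
      real_inner_smul_right, E.inner_resolvent hl]
  rw [inner_sub_right, sub_sub_cancel_left, norm_neg, h1]
  calc ‖inner ℝ (E.fc ((l • invFn l) * rpowExpFn γ) f) g‖
      ≤ ‖E.fc ((l • invFn l) * rpowExpFn γ) f‖ * ‖g‖ := norm_inner_le_norm _ _
    _ ≤ l ^ γ * ‖f‖ * ‖g‖ := by
      gcongr
      exact ContinuousLinearMap.le_of_opNorm_le _
        ((E.norm_fc_le _).trans (norm_smul_invFn_mul_rpowExpFn_le hγ hγ1 hl)) _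

end DirichletForm

/-! ### The resolvent is sub-Markovian and contracts `L^q` -/

namespace DirichletForm

variable {X : Type*} [MeasurableSpace X] {m : Measure X}

/-- `u = l (l + Δ)⁻¹ f` minimizes `𝓔(u, u) + l ‖u - f‖²`, so it agrees with its truncation. -/
theorem smul_resolvent_mem_Icc (E : DirichletForm m) {l : ℝ} (hl : 0 < l) {f : Lp ℝ 2 m}
    (h0 : ∀ᵐ x ∂m, 0 ≤ f x) (h1 : ∀ᵐ x ∂m, f x ≤ 1) :
    ∀ᵐ x ∂m, (l • E.resolvent l f) x ∈ Set.Icc (0 : ℝ) 1 := by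
  obtain ⟨hu, hu'⟩ := (E.isLaplacian_resolvent l hl f).smul l
  set u := l • E.resolvent l f
  obtain ⟨v, hv, hvE⟩ := E.markov ⟨u, hu⟩
  have h2 := E.nonneg (⟨u, hu⟩ - v)
  have h3 : E.form ⟨u, hu⟩ (⟨u, hu⟩ - v) = l * inner ℝ (f - u) (u - (v : Lp ℝ 2 m)) := by
    rw [← real_inner_smul_left]
    exact hu' _
  simp only [map_sub, LinearMap.sub_apply, E.symm v ⟨u, hu⟩] at h2
  rw [map_sub] at h3
  have h4 : inner ℝ (f - (v : Lp ℝ 2 m)) (u - v) ≤ 0 := by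
    rw [L2.inner_def]
    refine integral_nonpos_of_ae ?_
    filter_upwards [h0, h1, hv, Lp.coeFn_sub f (v : Lp ℝ 2 m), Lp.coeFn_sub u (v : Lp ℝ 2 m)]
      with x hx0 hx1 hxv hx2 hx3
    rw [hx2, hx3, Pi.sub_apply, Pi.sub_apply, hxv]
    simp only [RCLike.inner_apply, conj_trivial, Pi.zero_apply]
    rcases le_total (u x) 0 with hu0 | hu0
    · rw [min_eq_left (hu0.trans zero_le_one), max_eq_left hu0]
      nlinarith
    · rcases le_total (u x) 1 with hu1 | hu1
      · rw [min_eq_left hu1, max_eq_right hu0]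
        simp
      · rw [min_eq_right hu1, max_eq_right zero_le_one]
        nlinarith
  have h5 : inner ℝ (f - (v : Lp ℝ 2 m)) (u - v)
      = inner ℝ (f - u) (u - v) + ‖u - v‖ ^ 2 := by
    rw [← real_inner_self_eq_norm_sq, ← inner_add_left]
    congr 1
    abel
  have h7 : ‖u - v‖ ^ 2 = 0 := by
    refine le_antisymm ?_ (sq_nonneg _)
    by_contra! h8
    have : l * inner ℝ (f - u) (u - v) < 0 := mul_neg_of_pos_of_neg hl (by linarith)
    linarith
  have h8 : u = v := sub_eq_zero.1 (norm_eq_zero.1 (pow_eq_zero_iff two_ne_zero |>.1 h7))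
  filter_upwards [hv] with x hx
  rw [h8, hx]
  exact ⟨le_max_left _ _, max_le zero_le_one (min_le_right _ _)⟩

theorem resolvent_nonneg (E : DirichletForm m) {l : ℝ} (hl : 0 < l) {f : Lp ℝ 2 m} {M : ℝ}
    (h0 : ∀ᵐ x ∂m, 0 ≤ f x) (h1 : ∀ᵐ x ∂m, f x ≤ M) :
    ∀ᵐ x ∂m, 0 ≤ (l • E.resolvent l f) x := by
  have hM : 0 < max M 1 := by positivity
  have h := E.smul_resolvent_mem_Icc hl (f := (max M 1)⁻¹ • f) ?_ ?_
  · rw [map_smul, smul_comm] at h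
    filter_upwards [h, Lp.coeFn_smul (max M 1)⁻¹ (l • E.resolvent l f)] with x hx hx2
    rw [hx2, Pi.smul_apply, smul_eq_mul] at hx
    exact nonneg_of_mul_nonneg_right hx.1 (by positivity)
  · filter_upwards [h0, Lp.coeFn_smul (max M 1)⁻¹ f] with x hx hx2
    rw [hx2, Pi.smul_apply, smul_eq_mul]
    positivity
  · filter_upwards [h1, Lp.coeFn_smul (max M 1)⁻¹ f] with x hx hx2
    rw [hx2, Pi.smul_apply, smul_eq_mul, inv_mul_le_iff₀ hM, mul_one]
    exact hx.trans (le_max_left _ _)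

theorem smul_resolvent_indicator_le (E : DirichletForm m) {l : ℝ} (hl : 0 < l) {A : Set X}
    (hA : MeasurableSet A) (hmA : m A ≠ ⊤) :
    ∀ᵐ x ∂m, (l • E.resolvent l (indicatorConstLp 2 hA hmA (1 : ℝ))) x ∈ Set.Icc (0 : ℝ) 1 := by
  refine E.smul_resolvent_mem_Icc hl ?_ ?_ <;>
  · filter_upwards [indicatorConstLp_coeFn (p := 2) (hs := hA) (hμs := hmA) (c := (1 : ℝ))]
      with x hx
    rw [hx]
    by_cases h : x ∈ A <;> simp [h]

/-- By symmetry, `l (l + Δ)⁻¹` does not increase the integral of a nonnegative function. -/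
theorem lintegral_smul_resolvent_le [SigmaFinite m] (E : DirichletForm m) {l : ℝ} (hl : 0 < l)
    {φ : Lp ℝ 2 m} {M : ℝ} (h0 : ∀ᵐ x ∂m, 0 ≤ φ x) (h1 : ∀ᵐ x ∂m, φ x ≤ M)
    (hint : Integrable φ m) :
    ∫⁻ x, ENNReal.ofReal ((l • E.resolvent l φ) x) ∂m ≤ ∫⁻ x, ENNReal.ofReal (φ x) ∂m := by
  refine lintegral_le_of_forall_fin_meas_le _ fun A hA hmA => ?_
  have hT := E.resolvent_nonneg hl h0 h1
  have hT1 := E.smul_resolvent_indicator_le hl hA hmA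
  set T1 := l • E.resolvent l (indicatorConstLp 2 hA hmA (1 : ℝ))
  have e1 : ∫ x in A, (l • E.resolvent l φ) x ∂m = ∫ x, T1 x * φ x ∂m := by
    rw [← L2.inner_indicatorConstLp_one (𝕜 := ℝ) hA hmA, real_inner_smul_right,
      ← E.inner_resolvent hl, ← real_inner_smul_left, L2.inner_def]
    refine integral_congr_ae (Eventually.of_forall fun x => ?_)
    simp [T1, mul_comm]
  have e2 : Integrable (fun x => T1 x * φ x) m := by
    have h := L2.integrable_inner (𝕜 := ℝ) φ T1
    simpa using h
  have e3 : ∫ x, T1 x * φ x ∂m ≤ ∫ x, φ x ∂m := by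
    refine integral_mono_ae e2 hint ?_
    filter_upwards [hT1, h0] with x hx hx0
    exact mul_le_of_le_one_left hx0 hx.2
  rw [← ofReal_integral_eq_lintegral_ofReal, ← ofReal_integral_eq_lintegral_ofReal hint h0, e1]
  · exact ENNReal.ofReal_le_ofReal e3
  · exact integrableOn_Lp_of_measure_ne_top _ fact_one_le_two_ennreal.elim hmA
  · exact ae_restrict_of_ae hT

theorem _root_.MeasureTheory.memLp_of_abs_le_of_eq_zero {f : X → ℝ}
    (hf : AEStronglyMeasurable f m) {M : ℝ} {A : Set X} (hA : MeasurableSet A)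
    (hmA : m A ≠ ⊤) (hM : ∀ᵐ x ∂m, |f x| ≤ M) (h0 : ∀ᵐ x ∂m, x ∉ A → f x = 0) (q : ENNReal) :
    MemLp f q m := by
  have h1 : MemLp (A.indicator fun _ => M) q m := memLp_indicator_const q hA M (Or.inr hmA)
  refine h1.mono' hf ?_
  filter_upwards [hM, h0] with x hx hx0
  by_cases hxA : x ∈ A
  · simpa [hxA] using hx
  · simp [hxA, hx0 hxA]

/-- Jensen's inequality for the sub-Markovian operator `T = l (l + Δ)⁻¹`. It follows from Young's
inequality `y g ≤ |g| ^ q / q + |y| ^ p / p`, to which `T` is applied for each constant `y`. -/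
theorem abs_smul_resolvent_rpow_le (E : DirichletForm m) {l : ℝ} (hl : 0 < l) {p q : ℝ}
    (hpq : q.HolderConjugate p) {g φ : Lp ℝ 2 m} {M : ℝ} {A : Set X} (hA : MeasurableSet A)
    (hmA : m A ≠ ⊤) (hM : ∀ᵐ x ∂m, |g x| ≤ M) (h0 : ∀ᵐ x ∂m, x ∉ A → g x = 0)
    (hφ : φ =ᵐ[m] fun x => |g x| ^ q) :
    ∀ᵐ x ∂m, |(l • E.resolvent l g) x| ^ q ≤ (l • E.resolvent l φ) x := by
  have hq : 0 < q := hpq.pos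
  have hp : 0 < p := hpq.symm.pos
  set I : Lp ℝ 2 m := indicatorConstLp 2 hA hmA (1 : ℝ)
  have hI : I =ᵐ[m] A.indicator fun _ => (1 : ℝ) := indicatorConstLp_coeFn
  have hTI := E.smul_resolvent_indicator_le hl hA hmA
  have hy : ∀ y : ℝ, ∀ᵐ x ∂m, y * (l • E.resolvent l g) x
      ≤ (l • E.resolvent l φ) x / q + |y| ^ p / p := by
    intro y
    have hw := E.resolvent_nonneg hl (f := q⁻¹ • φ + (|y| ^ p / p) • I - y • g)
      (M := q⁻¹ * M ^ q + |y| ^ p / p + |y| * M) ?_ ?_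
    · have e : l • E.resolvent l (q⁻¹ • φ + (|y| ^ p / p) • I - y • g)
          = q⁻¹ • (l • E.resolvent l φ) + (|y| ^ p / p) • (l • E.resolvent l I)
            - y • (l • E.resolvent l g) := by
        simp only [map_sub, map_add, map_smul, smul_sub, smul_add, smul_comm l]
      rw [e] at hw
      filter_upwards [hw, hTI, Lp.coeFn_sub (q⁻¹ • (l • E.resolvent l φ) + (|y| ^ p / p) •
        (l • E.resolvent l I)) (y • (l • E.resolvent l g)), Lp.coeFn_add
        (q⁻¹ • (l • E.resolvent l φ)) ((|y| ^ p / p) • (l • E.resolvent l I)),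
        Lp.coeFn_smul q⁻¹ (l • E.resolvent l φ), Lp.coeFn_smul (|y| ^ p / p) (l • E.resolvent l I),
        Lp.coeFn_smul y (l • E.resolvent l g)] with x h1 h2 h3 h4 h5 h6 h7
      rw [h3, Pi.sub_apply, h4, Pi.add_apply, h5, h6, h7] at h1
      simp only [Pi.smul_apply, smul_eq_mul] at h1
      have h8 : |y| ^ p / p * (l • E.resolvent l I) x ≤ |y| ^ p / p :=
        mul_le_of_le_one_right (by positivity) h2.2
      rw [div_eq_inv_mul]
      linarith
    · filter_upwards [hφ, hI, h0, Lp.coeFn_sub (q⁻¹ • φ + (|y| ^ p / p) • I) (y • g),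
        Lp.coeFn_add (q⁻¹ • φ) ((|y| ^ p / p) • I), Lp.coeFn_smul q⁻¹ φ,
        Lp.coeFn_smul (|y| ^ p / p) I, Lp.coeFn_smul y g] with x h1 h2 h2' h3 h4 h5 h6 h7
      rw [h3, Pi.sub_apply, h4, Pi.add_apply, h5, h6, h7]
      simp only [Pi.smul_apply, smul_eq_mul, h1, h2]
      by_cases hx : x ∈ A
      · have := Real.young_inequality (g x) y hpq
        rw [Set.indicator_of_mem hx, sub_nonneg, mul_one, ← div_eq_inv_mul, mul_comm y]
        exact this
      · simp [hx, h2' hx, Real.zero_rpow hq.ne']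
    · filter_upwards [hφ, hI, hM, Lp.coeFn_sub (q⁻¹ • φ + (|y| ^ p / p) • I) (y • g),
        Lp.coeFn_add (q⁻¹ • φ) ((|y| ^ p / p) • I), Lp.coeFn_smul q⁻¹ φ,
        Lp.coeFn_smul (|y| ^ p / p) I, Lp.coeFn_smul y g] with x h1 h2 h2' h3 h4 h5 h6 h7
      rw [h3, Pi.sub_apply, h4, Pi.add_apply, h5, h6, h7]
      simp only [Pi.smul_apply, smul_eq_mul, h1, h2]
      have a1 : |g x| ^ q ≤ M ^ q := by gcongr
      have a2 : A.indicator (fun _ => (1 : ℝ)) x ≤ 1 := Set.indicator_le_self' (by simp) x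
      have a3 : -(y * g x) ≤ |y| * M := by
        calc -(y * g x) ≤ |y * g x| := neg_le_abs _
          _ = |y| * |g x| := abs_mul _ _
          _ ≤ |y| * M := by gcongr
      have a4 : |y| ^ p / p * A.indicator (fun _ => (1 : ℝ)) x ≤ |y| ^ p / p :=
        mul_le_of_le_one_right (by positivity) a2
      have a5 : q⁻¹ * |g x| ^ q ≤ q⁻¹ * M ^ q := by gcongr
      linarith
  filter_upwards [ae_all_iff.2 fun y : ℚ => hy y] with x hx
  set a := (l • E.resolvent l g) x
  set b := (l • E.resolvent l φ) x
  have hclosed : IsClosed {y : ℝ | y * a ≤ b / q + |y| ^ p / p} := by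
    refine isClosed_le (by fun_prop) ?_
    exact continuous_const.add (((continuous_abs).rpow_const fun _ => Or.inr hp.le).div_const p)
  have hall : ∀ y : ℝ, y * a ≤ b / q + |y| ^ p / p := 
    isClosed_property Rat.denseRange_cast hclosed hx
  have e1 : SignType.sign a * |a| ^ (q - 1) * a = |a| ^ q := by
    rcases eq_or_ne a 0 with ha | ha
    · simp [ha, Real.zero_rpow hq.ne']
    · rw [mul_right_comm, sign_mul_self]
      nth_rewrite 1 [← Real.rpow_one |a|]
      rw [← Real.rpow_add (abs_pos.2 ha)]
      ring_nf
  have e2 : |(SignType.sign a * |a| ^ (q - 1) : ℝ)| ^ p = |a| ^ q := by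
    rcases eq_or_ne a 0 with ha | ha
    · simp [ha, Real.zero_rpow hq.ne', Real.zero_rpow hp.ne']
    · rw [abs_mul, abs_of_nonneg (Real.rpow_nonneg (abs_nonneg a) _)]
      have : |(SignType.sign a : ℝ)| = 1 := by
        rcases lt_or_gt_of_ne ha with h | h <;> simp [h]
      rw [this, one_mul, ← Real.rpow_mul (abs_nonneg a), hpq.sub_one_mul_conj]
  -- Equality in Young's inequality is attained at this `y`.
  have h := hall (SignType.sign a * |a| ^ (q - 1))
  rw [e1, e2] at h
  have h9 : 1 / q + 1 / p = 1 := by simpa using hpq.inv_add_inv_eq_one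
  have h10 : |a| ^ q = |a| ^ q / q + |a| ^ q / p := by
    rw [div_eq_mul_one_div, div_eq_mul_one_div _ p, ← mul_add, h9, mul_one]
  have h11 : |a| ^ q / q ≤ b / q := by linarith
  exact (div_le_div_iff_of_pos_right hq).1 h11

/-- `l (l + Δ)⁻¹` contracts `L^q`, `1 < q < ∞`, on bounded functions supported in sets of finite
measure. -/
theorem eLpNorm_smul_resolvent_le [SigmaFinite m] (E : DirichletForm m) {l : ℝ} (hl : 0 < l)
    {p q : ℝ} (hpq : q.HolderConjugate p) {g : Lp ℝ 2 m} {M : ℝ} {A : Set X}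
    (hA : MeasurableSet A) (hmA : m A ≠ ⊤) (hM : ∀ᵐ x ∂m, |g x| ≤ M)
    (h0 : ∀ᵐ x ∂m, x ∉ A → g x = 0) :
    eLpNorm (l • E.resolvent l g : Lp ℝ 2 m) (ENNReal.ofReal q) m
      ≤ eLpNorm g (ENNReal.ofReal q) m := by
  have hq : 0 < q := hpq.pos
  have hmeas : AEStronglyMeasurable (fun x => |g x| ^ q) m :=
    ((Lp.aestronglyMeasurable g).aemeasurable.norm.pow_const q).aestronglyMeasurable
  have hM2 : ∀ᵐ x ∂m, |(|g x| ^ q)| ≤ M ^ q := hM.mono fun x hx => by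
    rw [abs_of_nonneg (by positivity)]; gcongr
  have h02 : ∀ᵐ x ∂m, x ∉ A → |g x| ^ q = 0 := h0.mono fun x hx hxA => by
    rw [hx hxA, abs_zero, Real.zero_rpow hq.ne']
  have hLp := memLp_of_abs_le_of_eq_zero hmeas hA hmA hM2 h02
  have hφ := (hLp 2).coeFn_toLp
  have h1 := E.abs_smul_resolvent_rpow_le hl hpq hA hmA hM h0 hφ
  have h2 := E.lintegral_smul_resolvent_le hl (φ := (hLp 2).toLp) (M := M ^ q)
    (hφ.mono fun x hx => by rw [hx]; positivity)
    (by filter_upwards [hφ, hM] with x hx hx2; rw [hx]; gcongr)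
    ((memLp_one_iff_integrable.1 (hLp 1)).congr hφ.symm)
  have hq0 : ENNReal.ofReal q ≠ 0 := by simpa using hq
  rw [eLpNorm_eq_lintegral_rpow_enorm_toReal hq0 ENNReal.ofReal_ne_top,
    eLpNorm_eq_lintegral_rpow_enorm_toReal hq0 ENNReal.ofReal_ne_top, ENNReal.toReal_ofReal hq.le]
  have e : ∀ a : ℝ, ‖a‖ₑ ^ q = ENNReal.ofReal (|a| ^ q) := fun a => by
    rw [Real.enorm_eq_ofReal_abs, ENNReal.ofReal_rpow_of_nonneg (abs_nonneg a) hq.le]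
  refine ENNReal.rpow_le_rpow ?_ (by positivity)
  simp only [e]
  calc ∫⁻ x, ENNReal.ofReal (|(l • E.resolvent l g : Lp ℝ 2 m) x| ^ q) ∂m
      ≤ ∫⁻ x, ENNReal.ofReal ((l • E.resolvent l (hLp 2).toLp) x) ∂m :=
        lintegral_mono_ae (h1.mono fun x hx => ENNReal.ofReal_le_ofReal hx)
    _ ≤ _ := h2
    _ = ∫⁻ x, ENNReal.ofReal (|g x| ^ q) ∂m := lintegral_congr_ae (hφ.mono fun x hx => by
        simp only [hx])

end DirichletForm

/-! ### Nonnegative symmetric bilinear forms -/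

section Bilinear

variable {V : Type*} [AddCommGroup V] [Module ℝ V] {B : V →ₗ[ℝ] V →ₗ[ℝ] ℝ}

theorem LinearMap.abs_apply_le_sqrt_mul_sqrt (hs : ∀ u v, B u v = B v u) (h0 : ∀ u, 0 ≤ B u u)
    (u v : V) : |B u v| ≤ √(B u u) * √(B v v) := by
  have h := LinearMap.BilinForm.apply_mul_apply_le_of_forall_zero_le B h0 u v
  rw [hs v u, ← sq] at h
  rw [← Real.sqrt_mul (h0 u)]
  exact Real.abs_le_sqrt h

theorem LinearMap.sqrt_apply_add_le (hs : ∀ u v, B u v = B v u) (h0 : ∀ u, 0 ≤ B u u) (u v : V) :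
    √(B (u + v) (u + v)) ≤ √(B u u) + √(B v v) := by
  refine Real.sqrt_le_iff.2 ⟨by positivity, ?_⟩
  have h := (le_abs_self _).trans (LinearMap.abs_apply_le_sqrt_mul_sqrt hs h0 u v)
  rw [add_sq, Real.sq_sqrt (h0 u), Real.sq_sqrt (h0 v)]
  simp only [map_add, LinearMap.add_apply, hs v u]
  linarith

theorem LinearMap.sqrt_apply_smul (c : ℝ) (u : V) : √(B (c • u) (c • u)) = |c| * √(B u u) := by
  simp only [map_smul, LinearMap.smul_apply, smul_eq_mul]
  rw [← mul_assoc, Real.sqrt_mul (mul_self_nonneg c), Real.sqrt_mul_self_eq_abs]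

theorem LinearMap.sqrt_apply_sub_le (hs : ∀ u v, B u v = B v u) (h0 : ∀ u, 0 ≤ B u u) (u v : V) :
    √(B (u - v) (u - v)) ≤ √(B u u) + √(B v v) := by
  have h := LinearMap.sqrt_apply_add_le hs h0 u (-v)
  rw [← sub_eq_add_neg] at h
  simpa using h

theorem LinearMap.abs_sqrt_apply_sub_sqrt_apply_le (hs : ∀ u v, B u v = B v u)
    (h0 : ∀ u, 0 ≤ B u u) (u v : V) :
    |√(B u u) - √(B v v)| ≤ √(B (u - v) (u - v)) := by
  have h1 := LinearMap.sqrt_apply_add_le hs h0 (u - v) v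
  have h2 := LinearMap.sqrt_apply_sub_le hs h0 u (u - v)
  rw [sub_add_cancel] at h1
  rw [sub_sub_cancel] at h2
  rw [abs_le]
  constructor <;> linarith

theorem LinearMap.sqrt_apply_sum_le (hs : ∀ u v, B u v = B v u) (h0 : ∀ u, 0 ≤ B u u) {K : ℝ}
    (w : ℕ → V) (hw : ∀ k, √(B (w k) (w k)) ≤ K) (N : ℕ) :
    √(B (∑ k ∈ Finset.range N, w k) (∑ k ∈ Finset.range N, w k)) ≤ N * K := by
  induction N with
  | zero => simp
  | succ N ih =>
    rw [Finset.sum_range_succ]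
    refine (LinearMap.sqrt_apply_add_le hs h0 _ _).trans ?_
    push_cast
    linarith [hw N]

end Bilinear

/-! ### The domain of a Dirichlet form -/

namespace DirichletForm

variable {X : Type*} [MeasurableSpace X] {m : Measure X}

/-- Lower semicontinuity: an `L²`-limit of an `𝓔`-bounded sequence is in `𝓕`. A weak limit is
obtained as a Riesz representative of a limit of functionals along an ultrafilter. -/
theorem mem_domain_of_tendsto (E : DirichletForm m) {u : ℕ → E.domain} {v : Lp ℝ 2 m} {C : ℝ}
    (hu : Tendsto (fun n => (u n : Lp ℝ 2 m)) atTop (𝓝 v)) (hC : ∀ n, E.form (u n) (u n) ≤ C) :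
    v ∈ E.domain := by
  let B : E.domain →ₗ[ℝ] E.domain →ₗ[ℝ] ℝ :=
    E.form + (innerₗ (Lp ℝ 2 m)).compl₁₂ E.domain.subtype E.domain.subtype
  have hB : ∀ u v : E.domain,
      B u v = E.form u v + inner ℝ (u : Lp ℝ 2 m) (v : Lp ℝ 2 m) := fun u v => by
    simp [B]
  have hB2 : ∀ u : E.domain, B u u = E.form u u + ‖(u : Lp ℝ 2 m)‖ ^ 2 := fun u => by
    rw [hB, real_inner_self_eq_norm_sq]
  have hpos : ∀ u, 0 ≤ B u u := fun u => by
    rw [hB2]; have := E.nonneg u; positivity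
  have hsymm : ∀ u v, B u v = B v u := fun u v => by
    rw [hB, hB, E.symm, real_inner_comm]
  have hdef : ∀ u, B u u = 0 → u = 0 := fun u h => by
    rw [hB2] at h
    have h1 := E.nonneg u
    have h2 : ‖(u : Lp ℝ 2 m)‖ ^ 2 = 0 := by nlinarith [sq_nonneg ‖(u : Lp ℝ 2 m)‖]
    exact Subtype.ext (norm_eq_zero.1 (pow_eq_zero_iff two_ne_zero |>.1 h2))
  obtain ⟨D, hD⟩ := (Metric.isBounded_range_of_tendsto _ hu).exists_norm_le
  have hK : ∀ n, √(B (u n) (u n)) ≤ √(C + D ^ 2) := fun n => by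
    refine Real.sqrt_le_sqrt ?_
    rw [hB2]
    have := hD _ ⟨n, rfl⟩
    gcongr
    exact hC n
  set K := √(C + D ^ 2)
  have hbound : ∀ n w, |B (u n) w| ≤ K * √(B w w) := fun n w =>
    (LinearMap.abs_apply_le_sqrt_mul_sqrt hsymm hpos _ _).trans (by gcongr; exact hK n)
  -- Each `B (u n) w` is a bounded real sequence; its limit along `U` is linear in `w`.
  let U : Ultrafilter ℕ := hyperfilter ℕ
  have hU : (U : Filter ℕ) ≤ atTop := by
    rw [← Nat.cofinite_eq_atTop]; exact hyperfilter_le_cofinite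
  have hlim : ∀ w, ∃ y ∈ Set.Icc (-(K * √(B w w))) (K * √(B w w)),
      Tendsto (fun n => B (u n) w) U (𝓝 y) := fun w =>
    isCompact_Icc.ultrafilter_le_nhds (U.map fun n => B (u n) w)
      (le_principal_iff.2 (Ultrafilter.mem_map.2 (univ_mem' fun n => abs_le.1 (hbound n w))))
  choose ℓ hℓ hℓlim using hlim
  let L : E.domain →ₗ[ℝ] ℝ :=
    { toFun := ℓ
      map_add' := fun w w' => by
        refine tendsto_nhds_unique (hℓlim _) ?_
        simpa using (hℓlim w).add (hℓlim w')
      map_smul' := fun c w => by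
        refine tendsto_nhds_unique (hℓlim _) ?_
        simpa using (hℓlim w).const_mul c }
  obtain ⟨z, hz⟩ := riesz_aux B hsymm hpos hdef
    (fun w hw => by
      obtain ⟨z, hz⟩ := E.closed w (by simpa only [hB2] using hw)
      exact ⟨z, by simpa only [hB2] using hz⟩)
    L K (fun w => abs_le.2 (hℓ w))
  have hres : ∀ (y : Lp ℝ 2 m) (hy : E.resolvent 1 y ∈ E.domain) (w : E.domain),
      B w ⟨_, hy⟩ = inner ℝ y (w : Lp ℝ 2 m) := fun y hy w => by
    obtain ⟨hy', h⟩ := E.isLaplacian_resolvent 1 one_pos y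
    rw [hsymm, hB, h, ← inner_add_left]
    simp
  -- `z` and `v` have the same inner products, as `B w (R y) = ⟪y, w⟫` is `L²`-continuous in `w`.
  have hzv : (z : Lp ℝ 2 m) = v := by
    refine ext_inner_left ℝ fun y => ?_
    obtain ⟨hy, -⟩ := E.isLaplacian_resolvent 1 one_pos y
    rw [← hres y hy, hz]
    refine tendsto_nhds_unique (hℓlim ⟨_, hy⟩) ?_
    simp only [hres]
    exact tendsto_const_nhds.inner (hu.mono_left hU)
  rw [← hzv]
  exact z.2

theorem exists_clip (E : DirichletForm m) (u : E.domain) {s : ℝ} (hs : 0 < s) :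
    ∃ w : E.domain, ((w : Lp ℝ 2 m) : X → ℝ) =ᵐ[m] (fun x => max 0 (min ((u : Lp ℝ 2 m) x) s)) ∧
      E.form w w ≤ E.form u u := by
  obtain ⟨v, hv, hvE⟩ := E.markov (s⁻¹ • u)
  refine ⟨s • v, ?_, ?_⟩
  · filter_upwards [hv, Lp.coeFn_smul s (v : Lp ℝ 2 m), Lp.coeFn_smul s⁻¹ (u : Lp ℝ 2 m)]
      with x h1 h2 h3
    have h4 : ((s • v : E.domain) : Lp ℝ 2 m) x = (s • (v : Lp ℝ 2 m)) x := rfl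
    have h5 : ((s⁻¹ • u : E.domain) : Lp ℝ 2 m) x = (s⁻¹ • (u : Lp ℝ 2 m)) x := rfl
    rw [h4, h2, Pi.smul_apply, h1, h5, h3, Pi.smul_apply, smul_eq_mul, smul_eq_mul,
      mul_max_of_nonneg _ _ hs.le, mul_min_of_nonneg _ _ hs.le, mul_zero, mul_one,
      mul_inv_cancel_left₀ hs.ne']
  · simp only [map_smul, LinearMap.smul_apply, smul_eq_mul] at hvE ⊢
    calc s * (s * E.form v v) ≤ s * (s * (s⁻¹ * (s⁻¹ * E.form u u))) := by gcongr
      _ = E.form u u := by field_simp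

/-- For `v ≥ 0`, the function `(v - s)⁺ = v - min v s` is in `𝓕`, with energy bounded uniformly in
`s`. -/
theorem exists_sub_pos (E : DirichletForm m) (v : E.domain) (h0 : ∀ᵐ x ∂m, 0 ≤ (v : Lp ℝ 2 m) x)
    {s : ℝ} (hs : 0 ≤ s) :
    ∃ w : E.domain, ((w : Lp ℝ 2 m) : X → ℝ) =ᵐ[m] (fun x => max 0 ((v : Lp ℝ 2 m) x - s)) ∧
      √(E.form w w) ≤ 2 * √(E.form v v) := by
  rcases hs.eq_or_lt with rfl | hs
  · refine ⟨v, ?_, by linarith [Real.sqrt_nonneg (E.form v v)]⟩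
    filter_upwards [h0] with x hx
    rw [sub_zero, max_eq_right hx]
  · obtain ⟨w, hw, hwE⟩ := E.exists_clip v hs
    refine ⟨v - w, ?_, ?_⟩
    · filter_upwards [h0, hw, Lp.coeFn_sub (v : Lp ℝ 2 m) (w : Lp ℝ 2 m)] with x hx h1 h2
      have h3 : ((v - w : E.domain) : Lp ℝ 2 m) x = ((v : Lp ℝ 2 m) - (w : Lp ℝ 2 m)) x := rfl
      rw [h3, h2, Pi.sub_apply, h1]
      rcases le_total ((v : Lp ℝ 2 m) x) s with h | h
      · rw [min_eq_left h, max_eq_right hx, max_eq_left (by linarith), sub_self]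
      · rw [min_eq_right h, max_eq_right hs.le, max_eq_right (by linarith)]
    · refine (LinearMap.sqrt_apply_sub_le E.symm E.nonneg v w).trans ?_
      linarith [Real.sqrt_le_sqrt hwE]

/-- Riemann sums for `v ^ 2 = ∫₀^∞ 2 (v - s)⁺ ds`. -/
theorem _root_.abs_two_mul_sum_posPart_sub_sq_le {v δ : ℝ} (hv : 0 ≤ v) (hδ : 0 ≤ δ) {N : ℕ}
    (hN : v ≤ N * δ) :
    |2 * δ * ∑ k ∈ Finset.range N, max 0 (v - k * δ) - v ^ 2| ≤ 2 * δ * v := by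
  -- With `b k = (v - k δ)⁺`, one has `2 δ b (k + 1) ≤ b k ^ 2 - b (k + 1) ^ 2 ≤ 2 δ b k`.
  have key : ∀ n : ℕ,
      v ^ 2 - max 0 (v - n * δ) ^ 2 ≤ 2 * δ * ∑ k ∈ Finset.range n, max 0 (v - k * δ) ∧
      2 * δ * ∑ k ∈ Finset.range n, max 0 (v - k * δ)
        ≤ v ^ 2 - max 0 (v - n * δ) ^ 2 + 2 * δ * (v - max 0 (v - n * δ)) := by
    intro n
    induction n with
    | zero => simp [max_eq_right hv]
    | succ n ih =>
      obtain ⟨h1, h2⟩ := ih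
      rw [Finset.sum_range_succ, mul_add]
      push_cast
      rcases le_total 0 (v - (n + 1) * δ) with h | h
      · have h' : 0 ≤ v - n * δ := by nlinarith
        rw [max_eq_right h] at *
        rw [max_eq_right h'] at *
        constructor <;> nlinarith
      · rw [max_eq_left h]
        rcases le_total 0 (v - n * δ) with h' | h'
        · rw [max_eq_right h'] at *
          constructor <;> nlinarith
        · rw [max_eq_left h'] at *
          constructor <;> nlinarith
  obtain ⟨h1, h2⟩ := key N
  rw [max_eq_left (by linarith : v - N * δ ≤ 0)] at h1 h2
  rw [abs_le]
  constructor <;> nlinarith [mul_nonneg hδ hv]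

theorem exists_sq_of_nonneg (E : DirichletForm m) (v : E.domain) {M : ℝ}
    (h0 : ∀ᵐ x ∂m, 0 ≤ (v : Lp ℝ 2 m) x) (hM : ∀ᵐ x ∂m, (v : Lp ℝ 2 m) x ≤ M) :
    ∃ w : E.domain, ((w : Lp ℝ 2 m) : X → ℝ) =ᵐ[m] fun x => (v : Lp ℝ 2 m) x ^ 2 := by
  have hM' : ∀ᵐ x ∂m, (v : Lp ℝ 2 m) x ≤ |M| := hM.mono fun x hx => hx.trans (le_abs_self M)
  have hmem : MemLp (fun x => (v : Lp ℝ 2 m) x ^ 2) 2 m := by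
    refine ((Lp.memLp (v : Lp ℝ 2 m)).const_mul |M|).mono
      ((Lp.aestronglyMeasurable _).pow 2) ?_
    filter_upwards [h0, hM'] with x h1 h2
    rw [Real.norm_of_nonneg (by positivity), Real.norm_of_nonneg (by positivity), sq]
    gcongr
  have hδ : ∀ N : ℕ, 0 ≤ |M| / (N + 1) := fun N => by positivity
  choose w hw hwE using fun N k : ℕ =>
    E.exists_sub_pos v h0 (mul_nonneg k.cast_nonneg (hδ N))
  let S : ℕ → E.domain := fun N =>
    (2 * (|M| / (N + 1))) • ∑ k ∈ Finset.range (N + 1), w N k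
  have hS : ∀ N, ((S N : Lp ℝ 2 m) : X → ℝ) =ᵐ[m] fun x =>
      2 * (|M| / (N + 1)) * ∑ k ∈ Finset.range (N + 1),
        max 0 ((v : Lp ℝ 2 m) x - k * (|M| / (N + 1))) := by
    intro N
    have e : (S N : Lp ℝ 2 m)
        = (2 * (|M| / (N + 1))) • ∑ k ∈ Finset.range (N + 1), (w N k : Lp ℝ 2 m) := by
      simp [S]
    rw [e]
    filter_upwards [Lp.coeFn_smul (2 * (|M| / ((N : ℝ) + 1)))
      (∑ k ∈ Finset.range (N + 1), (w N k : Lp ℝ 2 m)),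
      Lp.coeFn_finsetSum (Finset.range (N + 1)) (fun k => (w N k : Lp ℝ 2 m)),
      ae_all_iff.2 fun k => hw N k] with x h1 h2 h3
    rw [h1, Pi.smul_apply, h2, smul_eq_mul, Finset.sum_apply]
    simp only [h3]
  have hlim : Tendsto (fun N => (S N : Lp ℝ 2 m)) atTop (𝓝 hmem.toLp) := by
    have hb : ∀ N, ‖(S N : Lp ℝ 2 m) - hmem.toLp‖ ≤ 2 * (|M| / (N + 1)) * ‖(v : Lp ℝ 2 m)‖ := by
      intro N
      refine Lp.norm_le_mul_norm_of_ae_le_mul ?_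
      filter_upwards [Lp.coeFn_sub (S N : Lp ℝ 2 m) hmem.toLp, hmem.coeFn_toLp, hS N, h0, hM']
        with x h1 h2 h3 h4 h5
      rw [h1, Pi.sub_apply, h2, h3, Real.norm_of_nonneg h4, Real.norm_eq_abs]
      refine abs_two_mul_sum_posPart_sub_sq_le h4 (hδ N) ?_
      push_cast
      rw [mul_div_cancel₀ _ (by positivity)]
      exact h5
    rw [tendsto_iff_norm_sub_tendsto_zero]
    refine squeeze_zero (fun _ => norm_nonneg _) hb ?_
    have := (tendsto_one_div_add_atTop_nhds_zero_nat (𝕜 := ℝ)).const_mul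
      (2 * |M| * ‖(v : Lp ℝ 2 m)‖)
    rw [mul_zero] at this
    refine this.congr fun N => ?_
    ring
  have hSE : ∀ N, E.form (S N) (S N) ≤ (4 * |M| * √(E.form v v)) ^ 2 := by
    intro N
    rw [← Real.sqrt_le_left (by positivity), LinearMap.sqrt_apply_smul,
      abs_of_nonneg (by positivity)]
    calc _ ≤ 2 * (|M| / (N + 1)) * (((N + 1 : ℕ) : ℝ) * (2 * √(E.form v v))) := by
          gcongr
          exact LinearMap.sqrt_apply_sum_le E.symm E.nonneg (w N) (hwE N) (N + 1)
      _ = 4 * |M| * √(E.form v v) := by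
          push_cast
          field_simp
          ring
  exact ⟨⟨_, E.mem_domain_of_tendsto hlim hSE⟩, hmem.coeFn_toLp⟩

/-- Bounded elements of `𝓕` have squares in `𝓕`. -/
theorem exists_sq (E : DirichletForm m) (u : E.domain) {M : ℝ}
    (hM : ∀ᵐ x ∂m, |(u : Lp ℝ 2 m) x| ≤ M) :
    ∃ w : E.domain, ((w : Lp ℝ 2 m) : X → ℝ) =ᵐ[m] fun x => (u : Lp ℝ 2 m) x ^ 2 := by
  have hK : 0 < max M 1 := by positivity
  -- `a` and `b` are the positive and the negative part of `u`.
  obtain ⟨a, ha, -⟩ := E.exists_clip u hK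
  obtain ⟨b, hb, -⟩ := E.exists_clip (-u) hK
  obtain ⟨a2, ha2⟩ := E.exists_sq_of_nonneg a (M := max M 1)
    (ha.mono fun x hx => by rw [hx]; exact le_max_left _ _)
    (ha.mono fun x hx => by rw [hx]; exact max_le hK.le (min_le_right _ _))
  obtain ⟨b2, hb2⟩ := E.exists_sq_of_nonneg b (M := max M 1)
    (hb.mono fun x hx => by rw [hx]; exact le_max_left _ _)
    (hb.mono fun x hx => by rw [hx]; exact max_le hK.le (min_le_right _ _))
  refine ⟨a2 + b2, ?_⟩
  filter_upwards [ha, hb, ha2, hb2, hM, Lp.coeFn_add (a2 : Lp ℝ 2 m) (b2 : Lp ℝ 2 m),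
    Lp.coeFn_neg (u : Lp ℝ 2 m)] with x h1 h2 h3 h4 h5 h6 h7
  have h8 : ((a2 + b2 : E.domain) : Lp ℝ 2 m) x = ((a2 : Lp ℝ 2 m) + (b2 : Lp ℝ 2 m)) x := rfl
  have h9 : ((-u : E.domain) : Lp ℝ 2 m) x = (-(u : Lp ℝ 2 m)) x := rfl
  rw [h8, h6, Pi.add_apply, h3, h4, h1, h2, h9, h7, Pi.neg_apply]
  have h10 := (abs_le.1 (h5.trans (le_max_left M 1)))
  rw [min_eq_left h10.2, min_eq_left (by linarith)]
  rcases le_total 0 ((u : Lp ℝ 2 m) x) with h | h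
  · rw [max_eq_right h, max_eq_left (by linarith)]; ring
  · rw [max_eq_left h, max_eq_right (by linarith)]; ring

end DirichletForm

/-! ### The energy as the integral of the carré du champ -/

namespace DirichletForm

variable {X : Type*} [MeasurableSpace X] {m : Measure X}

theorem isClosed_essSupport [TopologicalSpace X] (u : Lp ℝ 2 m) : IsClosed (essSupport u) := by
  rw [← isOpen_compl_iff, isOpen_iff_forall_mem_open]
  intro x hx
  simp only [essSupport, Set.mem_compl_iff, Set.mem_ofPred_eq, not_forall, not_not] at hx
  obtain ⟨U, hU, hxU, h⟩ := hx
  refine ⟨U, fun y hy hy2 => hy2 U hU hy h, hU, hxU⟩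

theorem essSupport_subset_tsupport [TopologicalSpace X] {u : Lp ℝ 2 m} {φ : X → ℝ}
    (h : u =ᵐ[m] φ) : essSupport u ⊆ tsupport φ := by
  intro x hx
  by_contra hxs
  refine hx (tsupport φ)ᶜ (isClosed_tsupport φ).isOpen_compl hxs (h.mono fun y hy hys => ?_)
  rw [hy, image_eq_zero_of_notMem_tsupport hys]

theorem isCompact_essSupport [TopologicalSpace X] {u : Lp ℝ 2 m} {φ : X → ℝ}
    (h : u =ᵐ[m] φ) (hφ : HasCompactSupport φ) : IsCompact (essSupport u) :=
  IsCompact.of_isClosed_subset hφ (isClosed_essSupport u) (essSupport_subset_tsupport h)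

/-- Cutoff functions in `𝓕 ∩ C_c(X)`: an element uniformly close to `2` near `K` is truncated
at `1`. -/
theorem IsRegular.exists_cutoff [TopologicalSpace X] [RegularSpace X]
    [LocallyCompactSpace X] {E : DirichletForm m} (hE : E.IsRegular) {K : Set X}
    (hK : IsCompact K) :
    ∃ (ψ : X → ℝ) (h : E.domain) (U : Set X), ((h : Lp ℝ 2 m) : X → ℝ) =ᵐ[m] ψ ∧
      HasCompactSupport ψ ∧ (∀ x, ψ x ∈ Set.Icc (0 : ℝ) 1) ∧ IsOpen U ∧ K ⊆ U ∧
      ∀ x ∈ U, ψ x = 1 := by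
  obtain ⟨K', hK', hKK'⟩ := exists_compact_superset hK
  obtain ⟨f, hf1, -, hfc, -⟩ :=
    exists_continuous_one_zero_of_isCompact hK' isClosed_empty (Set.disjoint_empty K')
  obtain ⟨ψ, v, -, hψc, hv, hψ⟩ := hE.2 (fun x => 2 * f x) (by fun_prop) hfc.mul_left 1 one_pos
  obtain ⟨h, hh, -⟩ := E.markov v
  refine ⟨fun x => max 0 (min (ψ x) 1), h, interior K', ?_, ?_, fun x => ?_, isOpen_interior,
    hKK', fun x hx => ?_⟩
  · filter_upwards [hh, hv] with x h1 h2
    rw [h1, h2]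
  · exact hψc.comp_left (g := fun y : ℝ => max 0 (min y 1)) (by simp)
  · exact ⟨le_max_left _ _, max_le zero_le_one (min_le_right _ _)⟩
  · have h1 := hf1 (interior_subset hx)
    have h2 := (abs_lt.1 (hψ x)).2
    rw [h1, Pi.one_apply] at h2
    beta_reduce
    rw [min_eq_right (by linarith), max_eq_right zero_le_one]

/-- `∫ Γ(u, u) dm = 𝓔(u, u)` on `𝓕 ∩ C_c(X)`: in the Leibniz identity for `f = g = u` and a cutoff
`h` that is `1` near the support of `u`, the term `𝓔(h, u ^ 2)` vanishes by strong locality. -/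
theorem CarreDuChamp.integral_eq_form_of_hasCompactSupport [TopologicalSpace X] [RegularSpace X]
    [LocallyCompactSpace X] [SigmaCompactSpace X]
    {E : DirichletForm m} (hreg : E.IsRegular)
    (hloc : E.IsStronglyLocal) (Γ : E.CarreDuChamp) (u : E.domain) {φ : X → ℝ}
    (hφ : Continuous φ) (hφc : HasCompactSupport φ) (hu : ((u : Lp ℝ 2 m) : X → ℝ) =ᵐ[m] φ) :
    ∫ x, Γ.Γ u u x ∂m = E.form u u := by
  obtain ⟨M, hM⟩ := hφ.bounded_above_of_compact_support hφc
  have hubd : ∀ᵐ x ∂m, |(u : Lp ℝ 2 m) x| ≤ M := hu.mono fun x hx => by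
    rw [hx]; exact hM x
  obtain ⟨w, hw⟩ := E.exists_sq u hubd
  let K := CompactExhaustion.choice X
  choose ψ h U hhψ hψc hψ01 hU hKU hψ1 using fun n =>
    hreg.exists_cutoff ((K.isCompact n).union hφc.isCompact)
  have hwφ : ((w : Lp ℝ 2 m) : X → ℝ) =ᵐ[m] fun x => φ x ^ 2 := by
    filter_upwards [hw, hu] with x h1 h2
    rw [h1, h2]
  have hw2 : HasCompactSupport fun x => φ x ^ 2 :=
    hφc.comp_left (g := fun y : ℝ => y ^ 2) (by simp)
  have hsupp : tsupport (fun x => φ x ^ 2) ⊆ tsupport φ :=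
    closure_mono fun x hx => by
      rw [Function.mem_support] at hx ⊢
      exact fun h0 => hx (by simp [h0])
  have hint : ∀ n, ∫ x, (h n : Lp ℝ 2 m) x * Γ.Γ u u x ∂m = E.form u u := by
    intro n
    have hbdd : MemLp (u : Lp ℝ 2 m) ⊤ m :=
      memLp_top_of_bound (Lp.aestronglyMeasurable _) M hubd
    have hbdd' : MemLp (h n : Lp ℝ 2 m) ⊤ m :=
      memLp_top_of_bound (Lp.aestronglyMeasurable _) 1 ((hhψ n).mono fun x hx => by
        rw [hx, Real.norm_of_nonneg (hψ01 n x).1]; exact (hψ01 n x).2)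
    have hprod : ((u : Lp ℝ 2 m) : X → ℝ)
        =ᵐ[m] fun x => (u : Lp ℝ 2 m) x * (h n : Lp ℝ 2 m) x := by
      filter_upwards [hu, hhψ n] with x h1 h2
      rw [h1, h2]
      by_cases hx : x ∈ tsupport φ
      · rw [hψ1 n x (hKU n (Or.inr hx)), mul_one]
      · rw [image_eq_zero_of_notMem_tsupport hx, zero_mul]
    have hl := Γ.leibniz u u (h n) u u w hbdd hbdd hbdd' hprod hprod
      (hw.mono fun x hx => hx.trans (sq _))
    have hzero : E.form (h n) w = 0 := by
      rw [E.symm]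
      refine hloc w (h n) (isCompact_essSupport hwφ hw2) (isCompact_essSupport (hhψ n) (hψc n))
        ⟨U n, 1, hU n, ?_, (hhψ n).mono fun x hx hxU => by rw [hx, hψ1 n x hxU]⟩
      exact ((essSupport_subset_tsupport hwφ).trans hsupp).trans
        (Set.subset_union_right.trans (hKU n))
    rw [hzero] at hl
    linarith
  have hΓ := L1.integrable_coeFn (Γ.Γ u u)
  have hlim : Tendsto (fun n => ∫ x, (h n : Lp ℝ 2 m) x * Γ.Γ u u x ∂m) atTop
      (𝓝 (∫ x, Γ.Γ u u x ∂m)) := by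
    refine tendsto_integral_of_dominated_convergence (fun x => ‖Γ.Γ u u x‖)
      (fun n => (Lp.aestronglyMeasurable _).mul hΓ.1) hΓ.norm (fun n => ?_) ?_
    · filter_upwards [hhψ n] with x hx
      rw [norm_mul, hx, Real.norm_of_nonneg (hψ01 n x).1]
      exact mul_le_of_le_one_left (norm_nonneg _) (hψ01 n x).2
    · filter_upwards [ae_all_iff.2 hhψ] with x hx
      refine tendsto_const_nhds.congr' ?_
      obtain ⟨n, hn⟩ := K.exists_mem x
      filter_upwards [eventually_ge_atTop n] with k hk
      rw [hx k, hψ1 k x (hKU k (Or.inl (K.subset hk hn))), one_mul]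
  simp only [hint] at hlim
  exact (tendsto_nhds_unique hlim tendsto_const_nhds)

/-- The bilinear form `(u, v) ↦ ∫ Γ(u, v) dm`. -/
def CarreDuChamp.integralForm {E : DirichletForm m} (Γ : E.CarreDuChamp) :
    E.domain →ₗ[ℝ] E.domain →ₗ[ℝ] ℝ :=
  Γ.Γ.compr₂
    { toFun := fun f => ∫ x, f x ∂m
      map_add' := fun f g => by
        rw [← integral_add (L1.integrable_coeFn f) (L1.integrable_coeFn g)]
        exact integral_congr_ae (Lp.coeFn_add f g)
      map_smul' := fun c f => by
        rw [RingHom.id_apply, smul_eq_mul, ← integral_const_mul]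
        exact integral_congr_ae (Lp.coeFn_smul c f) }

theorem CarreDuChamp.integralForm_apply {E : DirichletForm m} (Γ : E.CarreDuChamp)
    (u v : E.domain) : Γ.integralForm u v = ∫ x, Γ.Γ u v x ∂m := rfl

/-- Both sides are continuous for the form norm, for which `𝓕 ∩ C_c(X)` is dense in `𝓕`. -/
theorem CarreDuChamp.integral_eq_form [TopologicalSpace X] [RegularSpace X]
    [LocallyCompactSpace X] [SigmaCompactSpace X]
    {E : DirichletForm m} (hreg : E.IsRegular)
    (hloc : E.IsStronglyLocal) (Γ : E.CarreDuChamp) (u v : E.domain) :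
    ∫ x, Γ.Γ u v x ∂m = E.form u v := by
  have hs : ∀ u v, Γ.integralForm u v = Γ.integralForm v u := fun u v => by
    rw [integralForm_apply, Γ.symm, integralForm_apply]
  have h0 : ∀ u, 0 ≤ Γ.integralForm u u := fun u => integral_nonneg_of_ae (Γ.nonneg u)
  obtain ⟨C, hC⟩ := Γ.continuous
  have hdiag : ∀ u, Γ.integralForm u u = E.form u u := by
    intro u
    have hclose : ∀ δ : ℝ, 0 < δ →
        |√(Γ.integralForm u u) - √(E.form u u)| ≤ √(|C| * δ) + √δ := by
      intro δ hδ
      obtain ⟨φ, v, hφ, hφc, hv, hd⟩ := hreg.1 u δ hδ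
      have h1 := LinearMap.abs_sqrt_apply_sub_sqrt_apply_le hs h0 u v
      have h2 := LinearMap.abs_sqrt_apply_sub_sqrt_apply_le E.symm E.nonneg u v
      have h3 : Γ.integralForm v v = E.form v v :=
        Γ.integral_eq_form_of_hasCompactSupport hreg hloc v hφ hφc hv
      have h4 : √(E.form (u - v) (u - v)) ≤ √δ := Real.sqrt_le_sqrt (by
        nlinarith [sq_nonneg ‖((u - v : E.domain) : Lp ℝ 2 m)‖])
      have h5 : √(Γ.integralForm (u - v) (u - v)) ≤ √(|C| * δ) := by
        refine Real.sqrt_le_sqrt ?_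
        calc Γ.integralForm (u - v) (u - v) ≤ ‖Γ.Γ (u - v) (u - v)‖ := by
              rw [L1.norm_eq_integral_norm]
              exact integral_mono_ae (L1.integrable_coeFn _) (L1.integrable_coeFn _).norm
                (Eventually.of_forall fun x => le_abs_self _)
          _ ≤ C * (E.form (u - v) (u - v) + ‖((u - v : E.domain) : Lp ℝ 2 m)‖ ^ 2) := hC _
          _ ≤ |C| * (E.form (u - v) (u - v) + ‖((u - v : E.domain) : Lp ℝ 2 m)‖ ^ 2) := by
              have := E.nonneg (u - v)
              gcongr
              exact le_abs_self C
          _ ≤ |C| * δ := by gcongr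
      rw [h3] at h1
      calc |√(Γ.integralForm u u) - √(E.form u u)|
          ≤ |√(Γ.integralForm u u) - √(E.form v v)| + |√(E.form v v) - √(E.form u u)| :=
            abs_sub_le _ _ _
        _ ≤ √(|C| * δ) + √δ := by
            rw [abs_sub_comm √(E.form v v)]
            linarith
    have hlim : Tendsto (fun δ : ℝ => √(|C| * δ) + √δ) (𝓝[>] 0) (𝓝 0) := by
      have : Continuous fun δ : ℝ => √(|C| * δ) + √δ := by fun_prop
      exact (this.tendsto' 0 0 (by simp)).mono_left nhdsWithin_le_nhds
    have h1 : |√(Γ.integralForm u u) - √(E.form u u)| ≤ 0 :=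
      ge_of_tendsto hlim (eventually_nhdsWithin_of_forall hclose)
    exact (Real.sqrt_inj (h0 u) (E.nonneg u)).1
      (sub_eq_zero.1 (abs_eq_zero.1 (le_antisymm h1 (abs_nonneg _))))
  have h := hdiag (u + v)
  simp only [map_add, LinearMap.add_apply, hdiag, hs v u, E.symm v u] at h
  rw [← integralForm_apply]
  linarith

/-- The Cauchy–Schwarz inequality for the values of `Γ`. -/
theorem CarreDuChamp.abs_le_gradNorm_mul_gradNorm {E : DirichletForm m} (Γ : E.CarreDuChamp)
    (u v : E.domain) : ∀ᵐ x ∂m, |Γ.Γ u v x| ≤ Γ.gradNorm u x * Γ.gradNorm v x := by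
  have h : ∀ r : ℚ, ∀ᵐ x ∂m,
      0 ≤ Γ.Γ v v x * ((r : ℝ) * r) + (2 * Γ.Γ u v x) * r + Γ.Γ u u x := by
    intro r
    have e : Γ.Γ (u + (r : ℝ) • v) (u + (r : ℝ) • v)
        = ((r : ℝ) * r) • Γ.Γ v v + ((2 * r : ℝ) • Γ.Γ u v + Γ.Γ u u) := by
      simp only [map_add, map_smul, LinearMap.add_apply, LinearMap.smul_apply, Γ.symm v u]
      module
    have hn := Γ.nonneg (u + (r : ℝ) • v)
    rw [e] at hn
    filter_upwards [hn, Lp.coeFn_add (((r : ℝ) * r) • Γ.Γ v v) ((2 * r : ℝ) • Γ.Γ u v + Γ.Γ u u),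
      Lp.coeFn_add ((2 * r : ℝ) • Γ.Γ u v) (Γ.Γ u u), Lp.coeFn_smul ((r : ℝ) * r) (Γ.Γ v v),
      Lp.coeFn_smul (2 * r : ℝ) (Γ.Γ u v)] with x h1 h2 h3 h4 h5
    rw [h2, Pi.add_apply, h3, Pi.add_apply, h4, h5] at h1
    simp only [Pi.smul_apply, smul_eq_mul] at h1
    linarith
  filter_upwards [ae_all_iff.2 h, Γ.nonneg u, Γ.nonneg v] with x hx hu hv
  -- The quadratic polynomial is nonnegative at rational, hence at real arguments.
  have hclosed : IsClosed {r : ℝ | 0 ≤ Γ.Γ v v x * (r * r) + (2 * Γ.Γ u v x) * r + Γ.Γ u u x} :=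
    isClosed_le continuous_const (by fun_prop)
  have hd := discrim_le_zero (isClosed_property Rat.denseRange_cast hclosed hx)
  rw [gradNorm, gradNorm, ← Real.sqrt_mul hu]
  refine Real.abs_le_sqrt ?_
  rw [discrim] at hd
  linarith

theorem CarreDuChamp.aestronglyMeasurable_gradNorm {E : DirichletForm m} (Γ : E.CarreDuChamp)
    (u : E.domain) : AEStronglyMeasurable (Γ.gradNorm u) m :=
  Real.continuous_sqrt.comp_aestronglyMeasurable (Lp.aestronglyMeasurable _)

theorem CarreDuChamp.abs_form_le [TopologicalSpace X] [RegularSpace X]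
    [LocallyCompactSpace X] [SigmaCompactSpace X]
    {E : DirichletForm m} (hreg : E.IsRegular)
    (hloc : E.IsStronglyLocal) (Γ : E.CarreDuChamp) {p q : ℝ} (hpq : q.HolderConjugate p)
    (u v : E.domain) :
    ENNReal.ofReal |E.form u v| ≤ eLpNorm (Γ.gradNorm u) (ENNReal.ofReal q) m *
      eLpNorm (Γ.gradNorm v) (ENNReal.ofReal p) m := by
  have hp0 : ENNReal.ofReal p ≠ 0 := by simpa using hpq.symm.pos
  have hq0 : ENNReal.ofReal q ≠ 0 := by simpa using hpq.pos
  rw [eLpNorm_eq_lintegral_rpow_enorm_toReal hq0 ENNReal.ofReal_ne_top,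
    eLpNorm_eq_lintegral_rpow_enorm_toReal hp0 ENNReal.ofReal_ne_top,
    ENNReal.toReal_ofReal hpq.nonneg, ENNReal.toReal_ofReal hpq.symm.nonneg]
  rw [← Γ.integral_eq_form hreg hloc, ← Real.enorm_eq_ofReal_abs]
  calc ‖∫ x, Γ.Γ u v x ∂m‖ₑ ≤ ∫⁻ x, ‖Γ.Γ u v x‖ₑ ∂m := enorm_integral_le_lintegral_enorm _
    _ ≤ ∫⁻ x, (fun x => ‖Γ.gradNorm u x‖ₑ) x * (fun x => ‖Γ.gradNorm v x‖ₑ) x ∂m := by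
        refine lintegral_mono_ae ((Γ.abs_le_gradNorm_mul_gradNorm u v).mono fun x hx => ?_)
        simp only
        rw [← enorm_mul, enorm_le_iff_norm_le, norm_mul]
        refine hx.trans ?_
        exact mul_le_mul (le_abs_self _) (le_abs_self _) (Real.sqrt_nonneg _) (norm_nonneg _)
    _ ≤ _ := ENNReal.lintegral_mul_le_Lp_mul_Lq m hpq
        (Γ.aestronglyMeasurable_gradNorm u).enorm (Γ.aestronglyMeasurable_gradNorm v).enorm

end DirichletForm

/-! ### Duality -/

section Duality

variable {X : Type*} [MeasurableSpace X] {m : Measure X}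

/-- The converse of Hölder's inequality, tested on bounded functions `g` supported in sets of finite
measure: `g = w |w| ^ (p - 2)` on the sets where `|w| ≤ n`. -/
theorem eLpNorm_le_of_forall_inner_le [SigmaFinite m] {p q : ℝ} (hpq : q.HolderConjugate p)
    (w : Lp ℝ 2 m) (K : ENNReal)
    (hK : ∀ (g : Lp ℝ 2 m) (M : ℝ) (A : Set X), MeasurableSet A → m A ≠ ⊤ →
      (∀ᵐ x ∂m, |g x| ≤ M) → (∀ᵐ x ∂m, x ∉ A → g x = 0) →
      ENNReal.ofReal |inner ℝ w g| ≤ K * eLpNorm g (ENNReal.ofReal q) m) :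
    eLpNorm w (ENNReal.ofReal p) m ≤ K := by
  have hp : 0 < p := hpq.symm.pos
  have hq : 0 < q := hpq.pos
  have hp0 : ENNReal.ofReal p ≠ 0 := by simpa using hp
  have hq0 : ENNReal.ofReal q ≠ 0 := by simpa using hq
  have hp1 : 0 < p - 1 := hpq.symm.sub_one_pos
  have hwm : Measurable (w : X → ℝ) := (Lp.stronglyMeasurable w).measurable
  let A : ℕ → Set X := fun n => spanningSets m n ∩ {x | |w x| ≤ n}
  have hA : ∀ n, MeasurableSet (A n) := fun n =>
    (measurableSet_spanningSets m n).inter (measurableSet_le hwm.norm measurable_const)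
  have hmA : ∀ n, m (A n) ≠ ⊤ := fun n =>
    ((measure_mono Set.inter_subset_left).trans_lt (measure_spanningSets_lt_top m n)).ne
  have hmono : Monotone A := fun i j hij => Set.inter_subset_inter (monotone_spanningSets m hij)
    fun x (hx : |w x| ≤ i) => hx.trans (by exact_mod_cast hij)
  have hunion : ⋃ n, A n = Set.univ := by
    refine Set.eq_univ_of_forall fun x => Set.mem_iUnion.2 ?_
    have hx : x ∈ ⋃ n, spanningSets m n := by rw [iUnion_spanningSets]; trivial
    obtain ⟨i, hi⟩ := Set.mem_iUnion.1 hx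
    obtain ⟨j, hj⟩ := exists_nat_ge |w x|
    exact ⟨max i j, monotone_spanningSets m (le_max_left i j) hi,
      hj.trans (by exact_mod_cast le_max_right i j)⟩
  have e : ∀ (a r : ℝ), 0 < r → ‖a‖ₑ ^ r = ENNReal.ofReal (|a| ^ r) := fun a r hr => by
    rw [Real.enorm_eq_ofReal_abs, ENNReal.ofReal_rpow_of_nonneg (abs_nonneg a) hr.le]
  have hI : ∀ n, ∫⁻ x in A n, ‖w x‖ₑ ^ p ∂m ≤ K ^ p := by
    intro n
    set I := ∫⁻ x in A n, ‖w x‖ₑ ^ p ∂m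
    let γ : X → ℝ := (A n).indicator fun x => w x * |w x| ^ (p - 2)
    have hγm : Measurable γ := (hwm.mul (hwm.norm.pow_const _)).indicator (hA n)
    have hγabs : ∀ x ∈ A n, |γ x| = |w x| ^ (p - 1) := fun x hx => by
      simp only [γ, Set.indicator_of_mem hx]
      rw [abs_mul, abs_of_nonneg (Real.rpow_nonneg (abs_nonneg (w x)) _)]
      rcases eq_or_ne (w x) 0 with h | h
      · simp [h, Real.zero_rpow hp1.ne']
      · nth_rewrite 1 [← Real.rpow_one |w x|]
        rw [← Real.rpow_add (abs_pos.2 h)]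
        ring_nf
    have hγ0 : ∀ x, x ∉ A n → γ x = 0 := fun x hx => Set.indicator_of_notMem hx _
    have hγM : ∀ x, |γ x| ≤ (n : ℝ) ^ (p - 1) := fun x => by
      by_cases hx : x ∈ A n
      · rw [hγabs x hx]
        exact Real.rpow_le_rpow (abs_nonneg _) hx.2 hp1.le
      · rw [hγ0 x hx, abs_zero]
        positivity
    have hγLp : MemLp γ 2 m := memLp_of_abs_le_of_eq_zero hγm.aestronglyMeasurable (hA n) (hmA n)
      (Eventually.of_forall hγM) (Eventually.of_forall hγ0) 2
    have hg := hγLp.coeFn_toLp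
    have h := hK hγLp.toLp _ (A n) (hA n) (hmA n) (hg.mono fun x hx => by rw [hx]; exact hγM x)
      (hg.mono fun x hx hxA => by rw [hx]; exact hγ0 x hxA)
    have hprod : ∀ x, γ x * w x = (A n).indicator (fun x => |w x| ^ p) x := fun x => by
      by_cases hx : x ∈ A n
      · simp only [γ, Set.indicator_of_mem hx]
        rw [mul_right_comm, ← sq, ← sq_abs]
        rcases eq_or_ne (w x) 0 with h | h
        · simp [h, Real.zero_rpow hp.ne']
        · rw [← Real.rpow_natCast, ← Real.rpow_add (abs_pos.2 h)]
          norm_num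
      · rw [hγ0 x hx, Set.indicator_of_notMem hx, zero_mul]
    have hinner : inner ℝ w hγLp.toLp = ∫ x in A n, |w x| ^ p ∂m := by
      rw [L2.inner_def, ← integral_indicator (hA n)]
      refine integral_congr_ae (hg.mono fun x hx => ?_)
      simp only [RCLike.inner_apply, conj_trivial, hx]
      exact hprod x
    have hintw : IntegrableOn (fun x => |w x| ^ p) (A n) m := by
      refine Measure.integrableOn_of_bounded (M := (n : ℝ) ^ p) (hmA n)
        (hwm.norm.pow_const p).aestronglyMeasurable ?_
      filter_upwards [ae_restrict_mem (hA n)] with x hx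
      rw [Real.norm_of_nonneg (by positivity)]
      exact Real.rpow_le_rpow (abs_nonneg _) hx.2 hp.le
    have hIeq : ENNReal.ofReal |inner ℝ w hγLp.toLp| = I := by
      rw [hinner, abs_of_nonneg (integral_nonneg fun x => by positivity),
        ofReal_integral_eq_lintegral_ofReal hintw (Eventually.of_forall fun x => by positivity)]
      simp only [I, e _ _ hp]
    have hIfin : I ≠ ⊤ := by rw [← hIeq]; exact ENNReal.ofReal_ne_top
    have hnorm : eLpNorm hγLp.toLp (ENNReal.ofReal q) m = I ^ (1 / q) := by
      rw [eLpNorm_congr_ae hg, eLpNorm_eq_lintegral_rpow_enorm_toReal hq0 ENNReal.ofReal_ne_top,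
        ENNReal.toReal_ofReal hq.le]
      congr 1
      simp only [I]
      rw [← lintegral_indicator (hA n)]
      refine lintegral_congr fun x => ?_
      by_cases hx : x ∈ A n
      · rw [Set.indicator_of_mem hx, e _ _ hq, e _ _ hp, hγabs x hx,
          ← Real.rpow_mul (abs_nonneg _), hpq.symm.sub_one_mul_conj]
      · rw [Set.indicator_of_notMem hx, hγ0 x hx, enorm_zero, ENNReal.zero_rpow_of_pos hq]
    rw [hIeq, hnorm] at h
    rcases eq_or_ne I 0 with h0 | h0
    · rw [h0]; exact zero_le
    · have hsum : 1 / p + 1 / q = 1 := by simpa using hpq.symm.inv_add_inv_eq_one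
      have hsplit : I = I ^ (1 / p) * I ^ (1 / q) := by
        rw [← ENNReal.rpow_add _ _ h0 hIfin, hsum, ENNReal.rpow_one]
      have hpos : I ^ (1 / q) ≠ 0 := (ENNReal.rpow_pos (pos_iff_ne_zero.2 h0) hIfin).ne'
      have hfin : I ^ (1 / q) ≠ ⊤ := ENNReal.rpow_ne_top_of_nonneg (by positivity) hIfin
      have h1 : I ^ (1 / p) ≤ K := by
        refine (ENNReal.mul_le_mul_iff_left hpos hfin).1 ?_
        rw [← hsplit]
        exact h
      calc I = (I ^ (1 / p)) ^ p := by
            rw [← ENNReal.rpow_mul, one_div_mul_cancel hp.ne', ENNReal.rpow_one]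
        _ ≤ K ^ p := ENNReal.rpow_le_rpow h1 hp.le
  rw [eLpNorm_eq_lintegral_rpow_enorm_toReal hp0 ENNReal.ofReal_ne_top,
    ENNReal.toReal_ofReal hp.le, one_div, ENNReal.rpow_inv_le_iff hp, ← setLIntegral_univ, ← hunion,
    setLIntegral_iUnion_of_directed _ hmono.directed_le]
  exact iSup_le hI

end Duality

end

/-! ### The reverse quasi-Riesz inequality -/

theorem lemma1p4 {X : Type*} [MetricSpace X] [LocallyCompactSpace X]
    [TopologicalSpace.SeparableSpace X] [MeasurableSpace X] [BorelSpace X]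
    (hX : ¬ Bornology.IsBounded (Set.univ : Set X))
    (m : Measure X) [IsFiniteMeasureOnCompacts m] [m.IsOpenPosMeasure]
    (E : DirichletForm m) (hreg : E.IsRegular) (hloc : E.IsStronglyLocal)
    (Γ : E.CarreDuChamp)
    (ε : ℝ) (hε0 : 0 < ε) (hε1 : ε < 1)
    (p p' : ℝ) (hp : 1 < p) (hpp' : 1 / p + 1 / p' = 1)
    (hR : Γ.QuasiRieszBounded ε p') :
    ∃ C : NNReal, 0 < C ∧ ∀ f : E.domain, ∃ w : Lp ℝ 2 m,
      E.IsPow (1 - ε) (E.heat 1 (f : Lp ℝ 2 m)) w ∧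
        eLpNorm w (ENNReal.ofReal p) m ≤
          C * eLpNorm (Γ.gradNorm f) (ENNReal.ofReal p) m := by
  have : SecondCountableTopology X := UniformSpace.secondCountable_of_separable X
  have hγ : 0 < 1 - ε := sub_pos.2 hε1
  have hγ1 : 1 - ε < 1 := by linarith
  have hpq : p'.HolderConjugate p := by
    refine Real.HolderConjugate.symm (Real.holderConjugate_iff.2 ⟨hp, ?_⟩)
    simpa using hpp'
  obtain ⟨C, hC, hR⟩ := hR
  refine ⟨2 * C, by positivity, fun f =>
    ⟨E.fc (rpowExpFn (1 - ε)) f, E.isPow_heat hγ hγ1 f, ?_⟩⟩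
  refine eLpNorm_le_of_forall_inner_le hpq _ _ fun g M A hA hmA hM h0 => ?_
  have hlim := (ENNReal.continuous_ofReal.tendsto _).comp
    (E.tendsto_inner_fc_sub_resolvent hγ hγ1 f g).abs
  refine le_of_tendsto hlim (eventually_nhdsWithin_of_forall fun l (hl : 0 < l) => ?_)
  obtain ⟨k, hk, hform⟩ := E.form_heat_eq_inner hγ hγ1 hl g
  have hRk := hR _ _ (E.isNegPow_sub_resolvent hε0 hε1 hl g) k hk
  have hg : eLpNorm (g - l • E.resolvent l g : Lp ℝ 2 m) (ENNReal.ofReal p') m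
      ≤ 2 * eLpNorm g (ENNReal.ofReal p') m := by
    rw [eLpNorm_congr_ae (Lp.coeFn_sub _ _), two_mul]
    refine (eLpNorm_sub_le (Lp.aestronglyMeasurable _) (Lp.aestronglyMeasurable _) ?_).trans ?_
    · exact ENNReal.one_le_ofReal.2 hpq.lt.le
    · gcongr
      exact E.eLpNorm_smul_resolvent_le hl hpq hA hmA hM h0
  rw [Function.comp_apply, ← hform]
  calc ENNReal.ofReal |E.form k f|
      ≤ eLpNorm (Γ.gradNorm k) (ENNReal.ofReal p') m
        * eLpNorm (Γ.gradNorm f) (ENNReal.ofReal p) m := Γ.abs_form_le hreg hloc hpq k f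
    _ ≤ (C * (2 * eLpNorm g (ENNReal.ofReal p') m))
        * eLpNorm (Γ.gradNorm f) (ENNReal.ofReal p) m := by
        gcongr
        exact hRk.trans (by gcongr)
    _ = (2 * C : NNReal) * eLpNorm (Γ.gradNorm f) (ENNReal.ofReal p) m
        * eLpNorm g (ENNReal.ofReal p') m := by
        push_cast
        ring
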